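/- **Two-order soliton of the Gerdjikov–Ivanov equation.** Consider the GI equation $$iq_t+q_{xx}-iq^2\bar q_x+\tfrac12 q^3\bar q^2=0 .$$ Let $k_1=\xi_1+i\eta_1$ with $\xi_1,\eta_1\in\mathbb R\setminus\{0\}$, let $r_0,\phi_0,\epsilon_1,\epsilon_2\in\mathbb R$, put $\beta_1=e^{-r_0+i\phi_0}$, and let $\varepsilon_1,\varepsilon_2\in\mathbb C$ satisfy $\varepsilon_2-\varepsilon_1=4\eta_1\epsilon_1-4i\xi_1\epsilon_2$. Let $\sigma_3=\mathrm{diag}(1,-1)$, $\theta(k)=\theta(x,t,k)=k^2x+2k^4t$, and let $\psi_0=e^{-i\theta\sigma_3}$ be the eigenfunction of the zero seed $q_0=0$. *Construction (one dressing step with poles of order two).* With a prime denoting $d/dk$, set $$\langle y|=(\beta_1,\beta_1^{-1})\,\psi_0^{-1}(k_1),\qquad \langle\tilde y|=(\varepsilon_1\beta_1,\varepsilon_2\beta_1^{-1})\,\psi_0^{-1}(k_1)+(\beta_1,\beta_1^{-1})\,(\psi_0^{-1})'(k_1),$$ $|y\rangle=\langle y|^\dagger$, $|\tilde y\rangle=\langle\tilde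 y|^\dagger$, $\delta=k_1^2-\bar k_1^2$, and, for row vectors $\langle u|,\langle v|$, set $\{u,v\}^\pm=\langle u|(I\pm\sigma_3)|v\rangle$ and $$\begin{aligned}a^\pm(u,v)&=k_1\{u,v\}^\pm+\bar k_1\{u,v\}^\mp,\qquad b^\pm(u,v)=(k_1^2+\bar k_1^2)\{u,v\}^\pm+2k_1\bar k_1\{u,v\}^\mp,\\ c^\pm(u,v)&=(k_1^3+3k_1\bar k_1^2)\{u,v\}^\pm+(\bar k_1^3+3\bar k_1k_1^2)\{u,v\}^\mp .\end{aligned}$$ Write $a_{11}^\pm=a^\pm(y,y)$, $a_{12}^\pm=a^\pm(y,\tilde y)$, $a_{21}^\pm=a^\pm(\tilde y,y)$, $a_{22}^\pm=a^\pm(\tilde y,\tilde y)$, and similarly for $b$ and $c$. Let $$\begin{aligned}\Delta^\pm={}&\delta^2(a_{21}^\pm a_{12}^\pm-a_{11}^\pm a_{22}^\pm)+2a_{11}^\pm c_{11}^\mp-b_{11}^\pm b_{11}^\mp\\&+\delta\,[a_{21}^\pm b_{11}^\mp-a_{12}^\pm b_{11}^\pm+a_{11}^\pm(b_{12}^\pm-b_{21}^\mp)],\end{aligned}$$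 and let $\Lambda,\Omega,\tilde\Lambda,\tilde\Omega$ be the diagonal $2\times2$ matrices whose first (upper sign) and second (lower sign) entries are $$\begin{gathered}-\frac{\delta^3}{\Delta^\pm}a_{11}^\pm,\qquad \frac{\delta^2}{\Delta^\pm}(\delta a_{12}^\pm+b_{11}^\mp),\qquad \frac{\delta^2}{\Delta^\pm}(\delta a_{21}^\pm-b_{11}^\pm),\\ \frac{\delta}{\Delta^\pm}\bigl[-\delta^2a_{22}^\pm+\delta(b_{12}^\pm-b_{21}^\mp)+2c_{11}^\mp\bigr],\end{gathered}$$ respectively. Put $|z\rangle=\Lambda|\tilde y\rangle+\Omega|y\rangle$, $|\tilde z\rangle=\tilde\Lambda|\tilde y\rangle+\tilde\Omega|y\rangle$, $A_1=|z\rangle\langle\tilde y|+|\tilde z\rangle\langle y|$, $\tilde A_1=|z\rangle\langle y|$. The *two-order soliton* is $$q=4i\,(A_1)_{12}.$$ *Result.* 1. For all real $x,t$, $\Delta^+\neq0$ and $\Delta^-\ne0$, and $$G(k)=I+\frac{A_1}{k-k_1}-\frac{\sigma_3A_1\sigma_3}{k+k_1}+\frac{\tilde A_1}{(k-k_1)^2}+\frac{\sigma_3\tilde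 A_1\sigma_3}{(k+k_1)^2}$$ satisfies $G(k)\,G(\bar k)^\dagger=I$ for every complex $k\notin\{\pm k_1,\pm\bar k_1\}$. 2. For all real $x,t$, $$q=4e^{-i\tilde\phi_1}\frac{N_2}{D_2},\qquad D_2\neq0,$$ where $\tilde\phi_1=2\phi_1-\pi/2$, $$\begin{aligned}N_2={}&(k_1^2-\bar k_1^2)^2|k_1|^2\left(\rho e^{-2r_1}+\bar\rho e^{2r_1}\right)\\&+(k_1^2-\bar k_1^2)\left[(\bar k_1^3+3\bar k_1k_1^2)e^{-2r_1}+(k_1^3+3k_1\bar k_1^2)e^{2r_1}\right],\\ D_2={}&4|k_1|^2\left(k_1e^{-2r_1}+\bar k_1e^{2r_1}\right)^2+(k_1^2-\bar k_1^2)^2(1-k_1\rho)(1+\bar k_1\bar\rho),\end{aligned}$$ $$\begin{aligned}r_1&=2\xi_1\eta_1x+8\xi_1\eta_1(\xi_1^2-\eta_1^2)t+r_0,\\ \phi_1&=(\xi_1^2-\eta_1^2)x+2[(\xi_1^2-\eta_1^2)^2-4\xi_1^2\eta_1^2]t+\phi_0,\end{aligned}$$ and $\rho=-2i\theta'(k_1)+\varepsilon_2-\varepsilon_1=\mu-i\nu$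 with $$\mu=4\eta_1[x+4(3\xi_1^2-\eta_1^2)t+\epsilon_1],\qquad \nu=4\xi_1[x+4(\xi_1^2-3\eta_1^2)t+\epsilon_2].$$ 3. $q$ is a $C^\infty$ function on $\mathbb R^2$ and solves the GI equation. -/

import Mathlib

open scoped Matrix ComplexConjugate ContDiff

noncomputable section

namespace GI

/-- `q` is a smooth classical solution on `ℝ × ℝ` of the Gerdjikov–Ivanov equation
`i q_t + q_xx - i q² (conj q)_x + (1/2) q³ (conj q)² = 0`. -/
def IsSolution (q : ℝ → ℝ → ℂ) : Prop :=
  ContDiff ℝ ∞ (fun p : ℝ × ℝ => q p.1 p.2) ∧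
  ∀ x t : ℝ,
    Complex.I * deriv (fun s => q x s) t + iteratedDeriv 2 (fun y => q y t) x
      - Complex.I * q x t ^ 2 * deriv (fun y => conj (q y t)) x
      + (1 / 2) * q x t ^ 3 * conj (q x t) ^ 2 = 0

/-- The Pauli matrix `σ₃ = diag(1, -1)`. -/
def sigma3 : Matrix (Fin 2) (Fin 2) ℂ := !![1, 0; 0, -1]

/-- The phase `θ(x, t, k) = k² x + 2 k⁴ t`. -/
def theta (x t : ℝ) (k : ℂ) : ℂ := k ^ 2 * x + 2 * k ^ 4 * t

/-- The eigenfunction `ψ₀ = exp(-i θ σ₃)` of the zero seed solution. -/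
def psi0 (x t : ℝ) (k : ℂ) : Matrix (Fin 2) (Fin 2) ℂ :=
  Matrix.diagonal
    ![Complex.exp (-(Complex.I * theta x t k)), Complex.exp (Complex.I * theta x t k)]

/-! ### One dressing step with poles of order two

Row vectors ("bras") `⟨y|` are functions `Fin 2 → ℂ`; the associated column vector is
`|y⟩ = ⟨y|†`, i.e. `star y`. The superscripts `±` are given by a parameter `s = ±1`. -/

/-- `⟨y| = Υ ψ⁻¹(k₁)`. -/
def bra (psi : ℂ → Matrix (Fin 2) (Fin 2) ℂ) (k₁ : ℂ) (U : Fin 2 → ℂ) : Fin 2 → ℂ :=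
  U ᵥ* (psi k₁)⁻¹

/-- The entrywise derivative `(ψ⁻¹)'(k₁)` with respect to the spectral parameter. -/
def psiInvDeriv (psi : ℂ → Matrix (Fin 2) (Fin 2) ℂ) (k₁ : ℂ) : Matrix (Fin 2) (Fin 2) ℂ :=
  Matrix.of fun i j => deriv (fun k => (psi k)⁻¹ i j) k₁

/-- `⟨ỹ| = Υ̃ ψ⁻¹(k₁) + Υ (ψ⁻¹)'(k₁)`. -/
def braTilde (psi : ℂ → Matrix (Fin 2) (Fin 2) ℂ) (k₁ : ℂ) (U U' : Fin 2 → ℂ) : Fin 2 → ℂ :=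
  U' ᵥ* (psi k₁)⁻¹ + U ᵥ* psiInvDeriv psi k₁

/-- `⟨u| (I + s σ₃) |v⟩`. -/
def form (s : ℂ) (u v : Fin 2 → ℂ) : ℂ := u ⬝ᵥ ((1 + s • sigma3) *ᵥ star v)

/-- The scalars `a^s`: `a₁₁ = aCoef y y`, `a₁₂ = aCoef y ỹ`, `a₂₁ = aCoef ỹ y`,
`a₂₂ = aCoef ỹ ỹ`; likewise for `bCoef` and `cCoef`. -/
def aCoef (k₁ s : ℂ) (u v : Fin 2 → ℂ) : ℂ :=
  k₁ * form s u v + conj k₁ * form (-s) u v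

def bCoef (k₁ s : ℂ) (u v : Fin 2 → ℂ) : ℂ :=
  (k₁ ^ 2 + conj k₁ ^ 2) * form s u v + 2 * k₁ * conj k₁ * form (-s) u v

def cCoef (k₁ s : ℂ) (u v : Fin 2 → ℂ) : ℂ :=
  (k₁ ^ 3 + 3 * k₁ * conj k₁ ^ 2) * form s u v
    + (conj k₁ ^ 3 + 3 * conj k₁ * k₁ ^ 2) * form (-s) u v

/-- `δ = k₁² - (conj k₁)²`. -/
def delta (k₁ : ℂ) : ℂ := k₁ ^ 2 - conj k₁ ^ 2

/-- The scalar `Δ^s`. -/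
def Delta (k₁ s : ℂ) (y y' : Fin 2 → ℂ) : ℂ :=
  delta k₁ ^ 2 * (aCoef k₁ s y' y * aCoef k₁ s y y' - aCoef k₁ s y y * aCoef k₁ s y' y')
    + 2 * aCoef k₁ s y y * cCoef k₁ (-s) y y - bCoef k₁ s y y * bCoef k₁ (-s) y y
    + delta k₁ * (aCoef k₁ s y' y * bCoef k₁ (-s) y y - aCoef k₁ s y y' * bCoef k₁ s y y
        + aCoef k₁ s y y * (bCoef k₁ s y y' - bCoef k₁ (-s) y' y))

/-- Diagonal entries of `Λ` (`s = 1`: first entry, `s = -1`: second entry). -/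
def Lam (k₁ s : ℂ) (y y' : Fin 2 → ℂ) : ℂ :=
  -(delta k₁ ^ 3 / Delta k₁ s y y') * aCoef k₁ s y y

/-- Diagonal entries of `Ω`. -/
def Om (k₁ s : ℂ) (y y' : Fin 2 → ℂ) : ℂ :=
  delta k₁ ^ 2 / Delta k₁ s y y' * (delta k₁ * aCoef k₁ s y y' + bCoef k₁ (-s) y y)

/-- Diagonal entries of `Λ̃`. -/
def LamTilde (k₁ s : ℂ) (y y' : Fin 2 → ℂ) : ℂ :=
  delta k₁ ^ 2 / Delta k₁ s y y' * (delta k₁ * aCoef k₁ s y' y - bCoef k₁ s y y)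

/-- Diagonal entries of `Ω̃`. -/
def OmTilde (k₁ s : ℂ) (y y' : Fin 2 → ℂ) : ℂ :=
  delta k₁ / Delta k₁ s y y' *
    (-(delta k₁ ^ 2) * aCoef k₁ s y' y' + delta k₁ * (bCoef k₁ s y y' - bCoef k₁ (-s) y' y)
      + 2 * cCoef k₁ (-s) y y)

/-- `|z⟩ = Λ |ỹ⟩ + Ω |y⟩`. -/
def ket (k₁ : ℂ) (y y' : Fin 2 → ℂ) : Fin 2 → ℂ :=
  Matrix.diagonal ![Lam k₁ 1 y y', Lam k₁ (-1) y y'] *ᵥ star y'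
    + Matrix.diagonal ![Om k₁ 1 y y', Om k₁ (-1) y y'] *ᵥ star y

/-- `|z̃⟩ = Λ̃ |ỹ⟩ + Ω̃ |y⟩`. -/
def ketTilde (k₁ : ℂ) (y y' : Fin 2 → ℂ) : Fin 2 → ℂ :=
  Matrix.diagonal ![LamTilde k₁ 1 y y', LamTilde k₁ (-1) y y'] *ᵥ star y'
    + Matrix.diagonal ![OmTilde k₁ 1 y y', OmTilde k₁ (-1) y y'] *ᵥ star y

/-- The coefficient `B = |z⟩⟨ỹ| + |z̃⟩⟨y|` of `1 / (k - k₁)` in the dressing factor. -/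
def residueB (k₁ : ℂ) (y y' : Fin 2 → ℂ) : Matrix (Fin 2) (Fin 2) ℂ :=
  Matrix.vecMulVec (ket k₁ y y') y' + Matrix.vecMulVec (ketTilde k₁ y y') y

/-- The coefficient `B̃ = |z⟩⟨y|` of `1 / (k - k₁)²` in the dressing factor. -/
def residueBTilde (k₁ : ℂ) (y y' : Fin 2 → ℂ) : Matrix (Fin 2) (Fin 2) ℂ :=
  Matrix.vecMulVec (ket k₁ y y') y

/-- A matrix with poles of order at most two at `±k₁`:
`I + B/(k-k₁) - σ₃Bσ₃/(k+k₁) + B̃/(k-k₁)² + σ₃B̃σ₃/(k+k₁)²`. -/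
def twoPole (k₁ : ℂ) (B B' : Matrix (Fin 2) (Fin 2) ℂ) (k : ℂ) : Matrix (Fin 2) (Fin 2) ℂ :=
  1 + (k - k₁)⁻¹ • B - (k + k₁)⁻¹ • (sigma3 * B * sigma3)
    + ((k - k₁) ^ 2)⁻¹ • B' + ((k + k₁) ^ 2)⁻¹ • (sigma3 * B' * sigma3)

/-! ### The two-order soliton: one step, zero seed -/

/-- `⟨y₁|` for `ψ₀` and `Υ₁ = (β₁, β₁⁻¹)`. -/
def y1 (k₁ β₁ : ℂ) (x t : ℝ) : Fin 2 → ℂ := bra (psi0 x t) k₁ ![β₁, β₁⁻¹]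

/-- `⟨ỹ₁|` for `ψ₀`, `Υ₁ = (β₁, β₁⁻¹)` and `Υ̃₁ = (ε₁ β₁, ε₂ β₁⁻¹)`. -/
def y1Tilde (k₁ β₁ ε₁ ε₂ : ℂ) (x t : ℝ) : Fin 2 → ℂ :=
  braTilde (psi0 x t) k₁ ![β₁, β₁⁻¹] ![ε₁ * β₁, ε₂ * β₁⁻¹]

/-- The coefficient `A₁ = B₁` of the dressing factor. -/
def A1 (k₁ β₁ ε₁ ε₂ : ℂ) (x t : ℝ) : Matrix (Fin 2) (Fin 2) ℂ :=
  residueB k₁ (y1 k₁ β₁ x t) (y1Tilde k₁ β₁ ε₁ ε₂ x t)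

/-- The coefficient `Ã₁ = B̃₁` of the dressing factor. -/
def A1Tilde (k₁ β₁ ε₁ ε₂ : ℂ) (x t : ℝ) : Matrix (Fin 2) (Fin 2) ℂ :=
  residueBTilde k₁ (y1 k₁ β₁ x t) (y1Tilde k₁ β₁ ε₁ ε₂ x t)

/-- The two-order soliton `q = q₀ + 4i (A₁)₁₂` with seed `q₀ = 0`. -/
def twoOrderSoliton (k₁ β₁ ε₁ ε₂ : ℂ) (x t : ℝ) : ℂ :=
  0 + 4 * Complex.I * A1 k₁ β₁ ε₁ ε₂ x t 0 1

/-! ### The explicit expressions (`k₁ = ξ₁ + i η₁`) -/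

def r1 (k₁ : ℂ) (r₀ : ℝ) (x t : ℝ) : ℝ :=
  2 * k₁.re * k₁.im * x + 8 * k₁.re * k₁.im * (k₁.re ^ 2 - k₁.im ^ 2) * t + r₀

def phi1 (k₁ : ℂ) (φ₀ : ℝ) (x t : ℝ) : ℝ :=
  (k₁.re ^ 2 - k₁.im ^ 2) * x
    + 2 * ((k₁.re ^ 2 - k₁.im ^ 2) ^ 2 - 4 * k₁.re ^ 2 * k₁.im ^ 2) * t + φ₀

def phi1Tilde (k₁ : ℂ) (φ₀ : ℝ) (x t : ℝ) : ℝ := 2 * phi1 k₁ φ₀ x t - Real.pi / 2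

def mu (k₁ : ℂ) (e₁ : ℝ) (x t : ℝ) : ℝ :=
  4 * k₁.im * (x + 4 * (3 * k₁.re ^ 2 - k₁.im ^ 2) * t + e₁)

def nu (k₁ : ℂ) (e₂ : ℝ) (x t : ℝ) : ℝ :=
  4 * k₁.re * (x + 4 * (k₁.re ^ 2 - 3 * k₁.im ^ 2) * t + e₂)

def rho (k₁ : ℂ) (e₁ e₂ : ℝ) (x t : ℝ) : ℂ := mu k₁ e₁ x t - Complex.I * nu k₁ e₂ x t

/-- The numerator. -/
def N2 (k₁ : ℂ) (r₀ e₁ e₂ : ℝ) (x t : ℝ) : ℂ :=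
  delta k₁ ^ 2 * (‖k₁‖ : ℂ) ^ 2 *
      (rho k₁ e₁ e₂ x t * Real.exp (-2 * r1 k₁ r₀ x t)
        + conj (rho k₁ e₁ e₂ x t) * Real.exp (2 * r1 k₁ r₀ x t))
    + delta k₁ *
      ((conj k₁ ^ 3 + 3 * conj k₁ * k₁ ^ 2) * Real.exp (-2 * r1 k₁ r₀ x t)
        + (k₁ ^ 3 + 3 * k₁ * conj k₁ ^ 2) * Real.exp (2 * r1 k₁ r₀ x t))

/-- The denominator. -/
def D2 (k₁ : ℂ) (r₀ e₁ e₂ : ℝ) (x t : ℝ) : ℂ :=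
  4 * (‖k₁‖ : ℂ) ^ 2 *
      (k₁ * Real.exp (-2 * r1 k₁ r₀ x t) + conj k₁ * Real.exp (2 * r1 k₁ r₀ x t)) ^ 2
    + delta k₁ ^ 2 * (1 - k₁ * rho k₁ e₁ e₂ x t)
        * (1 + conj k₁ * conj (rho k₁ e₁ e₂ x t))

end GI

end

/-!
The claim has three independent ingredients.

*The dressing factor.* By partial fractions, a product of two rational matrix functions which are
`1` at infinity is `1` as soon as its principal parts vanish (`one_add_polePart_mul_eq_one`). The
reduction `G(-k) = σ₃ G(k) σ₃` and passage to adjoints leave only the conditions at `k₁`, and there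
they follow from `⟨y| H(k₁) = 0` and `⟨ỹ| H(k₁) + ⟨y| H'(k₁) = 0` with `H(k) = G(conj k)†`. For each
of the two components these are two linear equations for the conjugates of the components of `|z⟩`
and `|z̃⟩`, and `Λ, Ω, Λ̃, Ω̃` are the solution by Cramer's rule, `Δ^±` being the determinant up to
conjugation and a constant multiple (`dressing_system`).

*The explicit formula.* For the zero seed the components of `⟨ỹ|` are multiples of those of `⟨y|`,
with ratios differing by `ρ`, and the components of `⟨y|` are `exp (∓(r₁ - i φ₁))`. Substituting
gives `Δ⁺ = 4 D₂` (`Delta_one_eq_D2`), `Δ⁻ = conj Δ⁺` (`conj_Delta`) and the formula for `q`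
(`twoOrderSoliton_eq`). At a zero of `D₂`, the vanishing imaginary part determines `Im (k₁ ρ)` from
`r₁`, and after this substitution the real part is a sum of squares with a positive term, which is
absurd (`D2_ne_zero`).

*The equation.* Writing `q = g / f` with `f = D₂`, the equation follows from three bilinear
identities (`equation_of_bilinear`). Both `f` and `g` are polynomials in `exp (±2 r₁)`,
`exp (-2 i φ₁)`, `ρ` and `conj ρ`, whose derivatives in `x` and `t` are again polynomials in these,
so that the bilinear identities become polynomial identities (`bilinear_dispersion`,
`bilinear_first_order`, `bilinear_second_order`).
-/

namespace GI

/-! ### Partial fractions and the reduction `k ↦ -k` -/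

section PartialFractions

/-- The principal part `X / (k - c) + X' / (k - c)²` of a pole of order two at `c`. -/
noncomputable def polePart (c : ℂ) (X X' : Matrix (Fin 2) (Fin 2) ℂ) (k : ℂ) :
    Matrix (Fin 2) (Fin 2) ℂ :=
  (k - c)⁻¹ • X + ((k - c) ^ 2)⁻¹ • X'

/-- The derivative of `polePart c X X'` with respect to `k`. -/
noncomputable def polePartDeriv (c : ℂ) (X X' : Matrix (Fin 2) (Fin 2) ℂ) (k : ℂ) :
    Matrix (Fin 2) (Fin 2) ℂ :=
  -((k - c) ^ 2)⁻¹ • X - (2 * ((k - c) ^ 3)⁻¹) • X'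

/-- Partial fraction decomposition of a product of two principal parts at different points. -/
lemma polePart_mul_polePart {c d k : ℂ} (hc : k ≠ c) (hd : k ≠ d) (hcd : c ≠ d)
    (X X' Y Y' : Matrix (Fin 2) (Fin 2) ℂ) :
    polePart c X X' k * polePart d Y Y' k =
      ((k - c) ^ 2)⁻¹ • (X' * polePart d Y Y' c)
        + (k - c)⁻¹ • (X * polePart d Y Y' c + X' * polePartDeriv d Y Y' c)
        + ((k - d) ^ 2)⁻¹ • (polePart c X X' d * Y')
        + (k - d)⁻¹ • (polePart c X X' d * Y + polePartDeriv c X X' d * Y') := by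
  have h1 : k - c ≠ 0 := sub_ne_zero.2 hc
  have h2 : k - d ≠ 0 := sub_ne_zero.2 hd
  have h3 : c - d ≠ 0 := sub_ne_zero.2 hcd
  have h4 : d - c ≠ 0 := sub_ne_zero.2 hcd.symm
  simp only [polePart, polePartDeriv, mul_add, add_mul, mul_sub, sub_mul, smul_mul_assoc,
    mul_smul_comm]
  have hu : (k - d)⁻¹ * (k - c)⁻¹ = (c - d)⁻¹ * ((k - c)⁻¹ - (k - d)⁻¹) := by
    field_simp
    ring
  have hw : (d - c)⁻¹ = -(c - d)⁻¹ := by rw [← neg_sub, inv_neg]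
  simp only [← inv_pow, hw]
  generalize (k - c)⁻¹ = u at *
  generalize (k - d)⁻¹ = p at *
  generalize (c - d)⁻¹ = w at *
  match_scalars
  · linear_combination hu
  · linear_combination (u - w) * hu
  · linear_combination (p + w) * hu
  · linear_combination (p * u + w * (u - p) - 2 * w ^ 2) * hu

/-- A product of two rational matrix functions, with double poles at `c₁, c₂` and `d₁, d₂` and
value `1` at infinity, is `1` as soon as the principal parts of the product at the four poles
vanish. -/
lemma one_add_polePart_mul_eq_one {c₁ c₂ d₁ d₂ k : ℂ} (hc₁ : k ≠ c₁) (hc₂ : k ≠ c₂)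
    (hd₁ : k ≠ d₁) (hd₂ : k ≠ d₂) (h₁₁ : c₁ ≠ d₁) (h₁₂ : c₁ ≠ d₂) (h₂₁ : c₂ ≠ d₁)
    (h₂₂ : c₂ ≠ d₂) (X X' V V' Y Y' W W' : Matrix (Fin 2) (Fin 2) ℂ)
    (hX' : X' * (1 + polePart d₁ Y Y' c₁ + polePart d₂ W W' c₁) = 0)
    (hX : X * (1 + polePart d₁ Y Y' c₁ + polePart d₂ W W' c₁)
      + X' * (polePartDeriv d₁ Y Y' c₁ + polePartDeriv d₂ W W' c₁) = 0)
    (hV' : V' * (1 + polePart d₁ Y Y' c₂ + polePart d₂ W W' c₂) = 0)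
    (hV : V * (1 + polePart d₁ Y Y' c₂ + polePart d₂ W W' c₂)
      + V' * (polePartDeriv d₁ Y Y' c₂ + polePartDeriv d₂ W W' c₂) = 0)
    (hY' : (1 + polePart c₁ X X' d₁ + polePart c₂ V V' d₁) * Y' = 0)
    (hY : (1 + polePart c₁ X X' d₁ + polePart c₂ V V' d₁) * Y
      + (polePartDeriv c₁ X X' d₁ + polePartDeriv c₂ V V' d₁) * Y' = 0)
    (hW' : (1 + polePart c₁ X X' d₂ + polePart c₂ V V' d₂) * W' = 0)
    (hW : (1 + polePart c₁ X X' d₂ + polePart c₂ V V' d₂) * W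
      + (polePartDeriv c₁ X X' d₂ + polePartDeriv c₂ V V' d₂) * W' = 0) :
    (1 + polePart c₁ X X' k + polePart c₂ V V' k)
      * (1 + polePart d₁ Y Y' k + polePart d₂ W W' k) = 1 := by
  simp only [mul_add, add_mul, one_mul, mul_one] at *
  rw [polePart_mul_polePart hc₁ hd₁ h₁₁, polePart_mul_polePart hc₁ hd₂ h₁₂,
    polePart_mul_polePart hc₂ hd₁ h₂₁, polePart_mul_polePart hc₂ hd₂ h₂₂]
  have e (c : ℂ) (X X' : Matrix (Fin 2) (Fin 2) ℂ) :
    polePart c X X' k = (k - c)⁻¹ • X + ((k - c) ^ 2)⁻¹ • X' := rfl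
  simp only [e]
  linear_combination (norm := module) ((k - c₁) ^ 2)⁻¹ • hX' + (k - c₁)⁻¹ • hX
    + ((k - c₂) ^ 2)⁻¹ • hV' + (k - c₂)⁻¹ • hV + ((k - d₁) ^ 2)⁻¹ • hY' + (k - d₁)⁻¹ • hY
    + ((k - d₂) ^ 2)⁻¹ • hW' + (k - d₂)⁻¹ • hW

lemma sigma3_mul_sigma3 : sigma3 * sigma3 = 1 := by
  simp [sigma3, Matrix.one_fin_two]

lemma conjTranspose_sigma3 : sigma3ᴴ = sigma3 := by
  ext i j; fin_cases i <;> fin_cases j <;> simp [sigma3]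

/-- The derivative of `twoPole k₁ B B'` with respect to `k`. -/
noncomputable def twoPoleDeriv (k₁ : ℂ) (B B' : Matrix (Fin 2) (Fin 2) ℂ) (k : ℂ) :
    Matrix (Fin 2) (Fin 2) ℂ :=
  polePartDeriv k₁ B B' k
    + polePartDeriv (-k₁) (-(sigma3 * B * sigma3)) (sigma3 * B' * sigma3) k

lemma twoPole_eq (k₁ : ℂ) (B B' : Matrix (Fin 2) (Fin 2) ℂ) (k : ℂ) :
    twoPole k₁ B B' k = 1 + polePart k₁ B B' k
      + polePart (-k₁) (-(sigma3 * B * sigma3)) (sigma3 * B' * sigma3) k := by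
  simp only [twoPole, polePart, sub_neg_eq_add]
  module

lemma sigma3_conj_conj (B : Matrix (Fin 2) (Fin 2) ℂ) :
    sigma3 * (sigma3 * B * sigma3) * sigma3 = B := by
  rw [← mul_assoc, ← mul_assoc, sigma3_mul_sigma3, one_mul, mul_assoc, sigma3_mul_sigma3, mul_one]

/-- The reduction `G(-k) = σ₃ G(k) σ₃`. -/
lemma twoPole_neg (k₁ : ℂ) (B B' : Matrix (Fin 2) (Fin 2) ℂ) (k : ℂ) :
    twoPole k₁ B B' (-k) = sigma3 * twoPole k₁ B B' k * sigma3 := by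
  have e1 : -k - k₁ = -(k + k₁) := by ring
  have e2 : -k + k₁ = -(k - k₁) := by ring
  simp only [twoPole, mul_add, add_mul, mul_sub, sub_mul, mul_smul_comm, smul_mul_assoc,
    sigma3_conj_conj, mul_one, sigma3_mul_sigma3, e1, e2, inv_neg, neg_sq]
  module

lemma twoPoleDeriv_neg (k₁ : ℂ) (B B' : Matrix (Fin 2) (Fin 2) ℂ) (k : ℂ) :
    twoPoleDeriv k₁ B B' (-k) = -(sigma3 * twoPoleDeriv k₁ B B' k * sigma3) := by
  have e1 : -k - k₁ = -(k + k₁) := by ring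
  have e2 : -k + k₁ = -(k - k₁) := by ring
  simp only [twoPoleDeriv, polePartDeriv, mul_add, add_mul, mul_sub, sub_mul, mul_smul_comm,
    smul_mul_assoc, mul_neg, neg_mul, sigma3_conj_conj, sub_neg_eq_add, e1, e2, neg_sq,
    Odd.neg_pow (show Odd 3 by decide), inv_neg]
  module

lemma sigma3_conj_mul (B C : Matrix (Fin 2) (Fin 2) ℂ) :
    (sigma3 * B * sigma3) * (sigma3 * C * sigma3) = sigma3 * (B * C) * sigma3 := by
  calc _ = sigma3 * B * (sigma3 * sigma3) * C * sigma3 := by simp only [mul_assoc]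
    _ = _ := by rw [sigma3_mul_sigma3]; simp only [mul_assoc, mul_one]

/-- By the reduction `G(-k) = σ₃ G(k) σ₃`, it suffices to cancel the principal parts of the
product at the poles `a` and `b`; those at `-a` and `-b` then cancel too. -/
lemma twoPole_mul_twoPole_eq_one {a b k : ℂ} (ha : k ≠ a) (ha' : k ≠ -a) (hb : k ≠ b)
    (hb' : k ≠ -b) (hab : a ≠ b) (hab' : a ≠ -b) (B B' C C' : Matrix (Fin 2) (Fin 2) ℂ)
    (hB' : B' * twoPole b C C' a = 0)
    (hB : B * twoPole b C C' a + B' * twoPoleDeriv b C C' a = 0)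
    (hC' : twoPole a B B' b * C' = 0)
    (hC : twoPole a B B' b * C + twoPoleDeriv a B B' b * C' = 0) :
    twoPole a B B' k * twoPole b C C' k = 1 := by
  rw [twoPole_eq, twoPole_eq]
  have hba : -a ≠ b := fun h => hab' (by rw [← h, neg_neg])
  refine one_add_polePart_mul_eq_one ha ha' hb hb' hab hab' hba (fun h => hab (neg_injective h))
    _ _ _ _ _ _ _ _ ?_ ?_ ?_ ?_ ?_ ?_ ?_ ?_
  all_goals rw [← twoPole_eq]
  · exact hB'
  · exact hB
  · rw [twoPole_neg, sigma3_conj_mul, hB', mul_zero, zero_mul]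
  · change _ + _ * twoPoleDeriv b C C' (-a) = 0
    rw [twoPole_neg, twoPoleDeriv_neg, neg_mul, mul_neg, sigma3_conj_mul, sigma3_conj_mul,
      ← neg_add, ← add_mul, ← mul_add, hB, mul_zero, zero_mul, neg_zero]
  · exact hC'
  · exact hC
  · rw [twoPole_neg, sigma3_conj_mul, hC', mul_zero, zero_mul]
  · change _ + twoPoleDeriv a B B' (-b) * _ = 0
    rw [twoPole_neg, twoPoleDeriv_neg, neg_mul, mul_neg, sigma3_conj_mul, sigma3_conj_mul,
      ← neg_add, ← add_mul, ← mul_add, hC, mul_zero, zero_mul, neg_zero]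

lemma conjTranspose_twoPole (k₁ k : ℂ) (B B' : Matrix (Fin 2) (Fin 2) ℂ) :
    (twoPole k₁ B B' k)ᴴ = twoPole (conj k₁) Bᴴ B'ᴴ (conj k) := by
  simp [twoPole, conjTranspose_sigma3, mul_assoc, Matrix.conjTranspose_smul]

lemma conjTranspose_twoPoleDeriv (k₁ k : ℂ) (B B' : Matrix (Fin 2) (Fin 2) ℂ) :
    (twoPoleDeriv k₁ B B' k)ᴴ = twoPoleDeriv (conj k₁) Bᴴ B'ᴴ (conj k) := by
  simp [twoPoleDeriv, polePartDeriv, conjTranspose_sigma3, mul_assoc, Matrix.conjTranspose_smul]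

end PartialFractions

/-! ### The linear system behind the dressing factor -/

section DressingSystem

lemma form_eq (s : ℂ) (u v : Fin 2 → ℂ) :
    form s u v = (1 + s) * (u 0 * conj (v 0)) + (1 - s) * (u 1 * conj (v 1)) := by
  simp [form, sigma3, Matrix.mulVec, dotProduct, Fin.sum_univ_two, Matrix.one_apply]
  ring

lemma conj_form {s : ℂ} (hs : conj s = s) (u v : Fin 2 → ℂ) :
    conj (form s u v) = form s v u := by
  simp [form_eq, hs]
  ring

lemma conj_aCoef {s : ℂ} (hs : conj s = s) (k₁ : ℂ) (u v : Fin 2 → ℂ) :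
    conj (aCoef k₁ s u v) = aCoef k₁ (-s) v u := by
  simp [aCoef, conj_form, hs]
  ring

lemma conj_bCoef {s : ℂ} (hs : conj s = s) (k₁ : ℂ) (u v : Fin 2 → ℂ) :
    conj (bCoef k₁ s u v) = bCoef k₁ s v u := by
  simp [bCoef, conj_form, hs, map_ofNat]
  ring

lemma conj_cCoef {s : ℂ} (hs : conj s = s) (k₁ : ℂ) (u v : Fin 2 → ℂ) :
    conj (cCoef k₁ s u v) = cCoef k₁ (-s) v u := by
  simp [cCoef, conj_form, hs, map_ofNat]
  ring

lemma conj_delta (k₁ : ℂ) : conj (delta k₁) = -delta k₁ := by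
  simp [delta]

lemma conj_Delta {s : ℂ} (hs : conj s = s) (k₁ : ℂ) (y y' : Fin 2 → ℂ) :
    conj (Delta k₁ s y y') = Delta k₁ (-s) y y' := by
  have hs' : conj (-s) = -s := by rw [map_neg, hs]
  simp [Delta, conj_aCoef, conj_bCoef, conj_cCoef, conj_delta, hs, map_ofNat]
  ring

lemma delta_eq (k₁ : ℂ) : delta k₁ = 4 * Complex.I * k₁.re * k₁.im := by
  apply Complex.ext <;> (simp [delta, pow_two]; try ring)

lemma delta_ne_zero {k₁ : ℂ} (hξ : k₁.re ≠ 0) (hη : k₁.im ≠ 0) : delta k₁ ≠ 0 := by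
  simp [delta_eq, hξ, hη]

/-- The linear system which determines the conjugates of one component of `|z⟩` and `|z̃⟩`:
its two equations are the components of `⟨y| H(k₁) = 0` and `⟨ỹ| H(k₁) + ⟨y| H'(k₁) = 0`, where
`H(k) = G(conj k)†`. Conjugation turns `Δ^s` into `Δ^{-s}`, the denominator that occurs here. -/
lemma dressing_system {k₁ s : ℂ} (hs : conj s = s) {y y' : Fin 2 → ℂ} (hδ : delta k₁ ≠ 0)
    (hΔ : Delta k₁ (-s) y y' ≠ 0) (c c' : ℂ) {z w : ℂ}
    (hz : z = Lam k₁ s y y' * conj c' + Om k₁ s y y' * conj c)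
    (hw : w = LamTilde k₁ s y y' * conj c' + OmTilde k₁ s y y' * conj c) :
    c + conj z * (aCoef k₁ (-s) y y' / delta k₁ + bCoef k₁ s y y / delta k₁ ^ 2)
        + conj w * (aCoef k₁ (-s) y y / delta k₁) = 0 ∧
    c' + conj z * (aCoef k₁ (-s) y' y' / delta k₁
          + (bCoef k₁ s y' y - bCoef k₁ (-s) y y') / delta k₁ ^ 2
          - 2 * cCoef k₁ s y y / delta k₁ ^ 3)
        + conj w * (aCoef k₁ (-s) y' y / delta k₁ - bCoef k₁ (-s) y y / delta k₁ ^ 2) = 0 := by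
  have hs' : conj (-s) = -s := by rw [map_neg, hs]
  subst hz hw
  simp only [map_add, map_mul, Lam, Om, LamTilde, OmTilde, conj_aCoef, conj_bCoef, conj_cCoef,
    conj_delta, conj_Delta, hs, hs', map_sub, map_neg, map_div₀, map_pow, Complex.conj_conj,
    neg_neg, map_ofNat]
  -- `D` stays opaque while denominators are cleared and is expanded by `e` only afterwards.
  have e : Delta k₁ (-s) y y' = Delta k₁ (-s) y y' := rfl
  conv_rhs at e => rw [Delta]
  rw [neg_neg] at e
  generalize Delta k₁ (-s) y y' = D at *
  generalize delta k₁ = d at *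
  constructor
  · field_simp
    subst e
    ring
  · field_simp
    subst e
    ring

variable {k₁ : ℂ} {y y' : Fin 2 → ℂ}

/-- The vector `⟨y| H(k₁)` for `H(k) = G(conj k)†`, with residues built from arbitrary columns
`z`, `w`. -/
lemma vecMul_twoPole (hδ : delta k₁ ≠ 0) (z w : Fin 2 → ℂ) :
    y ᵥ* twoPole (conj k₁) (Matrix.vecMulVec z y' + Matrix.vecMulVec w y)ᴴ
        (Matrix.vecMulVec z y)ᴴ k₁ =
      ![y 0 + conj (z 0) * (aCoef k₁ (-1) y y' / delta k₁ + bCoef k₁ 1 y y / delta k₁ ^ 2)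
          + conj (w 0) * (aCoef k₁ (-1) y y / delta k₁),
        y 1 + conj (z 1) * (aCoef k₁ 1 y y' / delta k₁ + bCoef k₁ (-1) y y / delta k₁ ^ 2)
          + conj (w 1) * (aCoef k₁ 1 y y / delta k₁)] := by
  have hd : delta k₁ = (k₁ - conj k₁) * (k₁ + conj k₁) := by rw [delta]; ring
  have h1 : k₁ - conj k₁ ≠ 0 := left_ne_zero_of_mul (hd ▸ hδ)
  have h2 : k₁ + conj k₁ ≠ 0 := right_ne_zero_of_mul (hd ▸ hδ)
  rw [hd]
  ext j
  fin_cases j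
  all_goals
    simp [twoPole, sigma3, Matrix.vecMul, dotProduct, Fin.sum_univ_two, Matrix.one_apply,
      Matrix.mul_apply, Matrix.vecMulVec_apply, aCoef, bCoef, form_eq]
    field_simp
    ring

/-- The vector `⟨ỹ| H(k₁) + ⟨y| H'(k₁)` for `H` as in `vecMul_twoPole`. -/
lemma vecMul_twoPole_add (hδ : delta k₁ ≠ 0) (z w : Fin 2 → ℂ) :
    y' ᵥ* twoPole (conj k₁) (Matrix.vecMulVec z y' + Matrix.vecMulVec w y)ᴴ
        (Matrix.vecMulVec z y)ᴴ k₁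
      + y ᵥ* twoPoleDeriv (conj k₁) (Matrix.vecMulVec z y' + Matrix.vecMulVec w y)ᴴ
        (Matrix.vecMulVec z y)ᴴ k₁ =
      ![y' 0 + conj (z 0) * (aCoef k₁ (-1) y' y' / delta k₁
          + (bCoef k₁ 1 y' y - bCoef k₁ (-1) y y') / delta k₁ ^ 2
          - 2 * cCoef k₁ 1 y y / delta k₁ ^ 3)
          + conj (w 0) * (aCoef k₁ (-1) y' y / delta k₁ - bCoef k₁ (-1) y y / delta k₁ ^ 2),
        y' 1 + conj (z 1) * (aCoef k₁ 1 y' y' / delta k₁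
          + (bCoef k₁ (-1) y' y - bCoef k₁ 1 y y') / delta k₁ ^ 2
          - 2 * cCoef k₁ (-1) y y / delta k₁ ^ 3)
          + conj (w 1) * (aCoef k₁ 1 y' y / delta k₁ - bCoef k₁ 1 y y / delta k₁ ^ 2)] := by
  have hd : delta k₁ = (k₁ - conj k₁) * (k₁ + conj k₁) := by rw [delta]; ring
  have h1 : k₁ - conj k₁ ≠ 0 := left_ne_zero_of_mul (hd ▸ hδ)
  have h2 : k₁ + conj k₁ ≠ 0 := right_ne_zero_of_mul (hd ▸ hδ)
  rw [hd]
  ext j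
  fin_cases j
  all_goals
    simp [twoPole, twoPoleDeriv, polePartDeriv, sigma3, Matrix.vecMul, dotProduct,
      Fin.sum_univ_two, Matrix.one_apply, Matrix.mul_apply, Matrix.vecMulVec_apply, aCoef, bCoef,
      cCoef, form_eq]
    field_simp
    ring

lemma ket_apply_zero : ket k₁ y y' 0 = Lam k₁ 1 y y' * conj (y' 0) + Om k₁ 1 y y' * conj (y 0) := by
  simp [ket]

lemma ket_apply_one :
    ket k₁ y y' 1 = Lam k₁ (-1) y y' * conj (y' 1) + Om k₁ (-1) y y' * conj (y 1) := by
  simp [ket]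

lemma ketTilde_apply_zero :
    ketTilde k₁ y y' 0 = LamTilde k₁ 1 y y' * conj (y' 0) + OmTilde k₁ 1 y y' * conj (y 0) := by
  simp [ketTilde]

lemma ketTilde_apply_one :
    ketTilde k₁ y y' 1 = LamTilde k₁ (-1) y y' * conj (y' 1)
      + OmTilde k₁ (-1) y y' * conj (y 1) := by
  simp [ketTilde]

/-- The dressing factor satisfies `G(k) G†(conj k) = 1`: the vectors `|z⟩`, `|z̃⟩` solve the linear
system saying that the product has no principal parts. -/
theorem twoPole_residue_mul_eq_one {k : ℂ} (hξ : k₁.re ≠ 0) (hη : k₁.im ≠ 0)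
    (hΔ : Delta k₁ 1 y y' ≠ 0) (hΔ' : Delta k₁ (-1) y y' ≠ 0) (hk₁ : k ≠ k₁) (hk₂ : k ≠ -k₁)
    (hk₃ : k ≠ conj k₁) (hk₄ : k ≠ -conj k₁) :
    twoPole k₁ (residueB k₁ y y') (residueBTilde k₁ y y') k
      * twoPole (conj k₁) (residueB k₁ y y')ᴴ (residueBTilde k₁ y y')ᴴ k = 1 := by
  have hδ := delta_ne_zero hξ hη
  have hd : delta k₁ = (k₁ - conj k₁) * (k₁ + conj k₁) := by rw [delta]; ring
  have hab : k₁ ≠ conj k₁ := sub_ne_zero.1 (left_ne_zero_of_mul (hd ▸ hδ))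
  have hab' : k₁ ≠ -conj k₁ := fun h => right_ne_zero_of_mul (hd ▸ hδ) (by
    nth_rewrite 1 [h]
    exact neg_add_cancel _)
  obtain ⟨p₀, d₀⟩ := dressing_system (s := 1) (by simp) hδ hΔ' (y 0) (y' 0)
    (ket_apply_zero (k₁ := k₁)) (ketTilde_apply_zero (k₁ := k₁))
  obtain ⟨p₁, d₁⟩ := dressing_system (s := -1) (by simp) hδ (by rwa [neg_neg]) (y 1) (y' 1)
    (ket_apply_one (k₁ := k₁)) (ketTilde_apply_one (k₁ := k₁))
  rw [neg_neg] at p₁ d₁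
  have hp : y ᵥ* twoPole (conj k₁) (residueB k₁ y y')ᴴ (residueBTilde k₁ y y')ᴴ k₁ = 0 := by
    rw [residueB, residueBTilde, vecMul_twoPole hδ, p₀, p₁]
    simp
  have hq : y' ᵥ* twoPole (conj k₁) (residueB k₁ y y')ᴴ (residueBTilde k₁ y y')ᴴ k₁
      + y ᵥ* twoPoleDeriv (conj k₁) (residueB k₁ y y')ᴴ (residueBTilde k₁ y y')ᴴ k₁ = 0 := by
    rw [residueB, residueBTilde, vecMul_twoPole_add hδ, d₀, d₁]
    simp
  have hB' : residueBTilde k₁ y y'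
      * twoPole (conj k₁) (residueB k₁ y y')ᴴ (residueBTilde k₁ y y')ᴴ k₁ = 0 := by
    conv_lhs => enter [1]; rw [residueBTilde]
    rw [Matrix.vecMulVec_mul, hp, Matrix.vecMulVec_zero]
  have hB : residueB k₁ y y'
        * twoPole (conj k₁) (residueB k₁ y y')ᴴ (residueBTilde k₁ y y')ᴴ k₁
      + residueBTilde k₁ y y'
        * twoPoleDeriv (conj k₁) (residueB k₁ y y')ᴴ (residueBTilde k₁ y y')ᴴ k₁ = 0 := by
    conv_lhs => enter [1, 1]; rw [residueB]
    conv_lhs => enter [2, 1]; rw [residueBTilde]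
    rw [add_mul, Matrix.vecMulVec_mul, Matrix.vecMulVec_mul, Matrix.vecMulVec_mul, hp,
      Matrix.vecMulVec_zero, add_zero, ← Matrix.vecMulVec_add, hq, Matrix.vecMulVec_zero]
  -- The conditions at `conj k₁` are the adjoints of those at `k₁`.
  refine twoPole_mul_twoPole_eq_one hk₁ hk₂ hk₃ hk₄ hab hab' _ _ _ _ hB' hB ?_ ?_
  · apply_fun Matrix.conjTranspose at hB'
    simpa [conjTranspose_twoPole] using hB'
  · apply_fun Matrix.conjTranspose at hB
    simpa [conjTranspose_twoPole, conjTranspose_twoPoleDeriv] using hB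

end DressingSystem

/-! ### The zero seed: vectors, `Δ⁺` and the denominator `D₂` -/

section ZeroSeed

variable {k₁ : ℂ}

lemma hasDerivAt_theta (x t : ℝ) (k : ℂ) :
    HasDerivAt (theta x t) (2 * k * x + 8 * k ^ 3 * t) k := by
  have := ((hasDerivAt_pow 2 k).mul_const (x : ℂ)).add
    (((hasDerivAt_pow 4 k).const_mul 2).mul_const (t : ℂ))
  refine (this.congr_deriv ?_)
  push_cast
  ring

lemma inv_psi0 (x t : ℝ) (k : ℂ) :
    (psi0 x t k)⁻¹ = Matrix.diagonal ![Complex.exp (Complex.I * theta x t k),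
      Complex.exp (-(Complex.I * theta x t k))] := by
  apply Matrix.inv_eq_right_inv
  rw [psi0, Matrix.diagonal_mul_diagonal, ← Matrix.diagonal_one]
  congr 1
  ext i
  fin_cases i <;> simp [← Complex.exp_add]

lemma psiInvDeriv_psi0 (x t : ℝ) (k : ℂ) :
    psiInvDeriv (psi0 x t) k = Matrix.diagonal
      ![Complex.exp (Complex.I * theta x t k) * (Complex.I * (2 * k * x + 8 * k ^ 3 * t)),
      Complex.exp (-(Complex.I * theta x t k)) * -(Complex.I * (2 * k * x + 8 * k ^ 3 * t))] := by
  have h := (hasDerivAt_theta x t k).const_mul Complex.I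
  ext i j
  rw [psiInvDeriv, Matrix.of_apply]
  simp only [inv_psi0]
  fin_cases i <;> fin_cases j
  · simpa using h.cexp.deriv
  · simp
  · simp
  · simpa using h.neg.cexp.deriv

lemma y1_eq (x t : ℝ) (k β : ℂ) :
    y1 k β x t = ![β * Complex.exp (Complex.I * theta x t k),
      β⁻¹ * Complex.exp (-(Complex.I * theta x t k))] := by
  rw [y1, bra, inv_psi0]
  ext i
  fin_cases i <;> simp [Matrix.vecMul_diagonal]

lemma y1Tilde_eq (x t : ℝ) (k β ε₁ ε₂ : ℂ) :
    y1Tilde k β ε₁ ε₂ x t =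
      ![y1 k β x t 0 * (ε₁ + Complex.I * (2 * k * x + 8 * k ^ 3 * t)),
        y1 k β x t 1 * (ε₂ - Complex.I * (2 * k * x + 8 * k ^ 3 * t))] := by
  rw [y1_eq, y1Tilde, braTilde, inv_psi0, psiInvDeriv_psi0]
  ext i
  fin_cases i <;> simp [Matrix.vecMul_diagonal] <;> ring

lemma rho_eq (k₁ : ℂ) (e₁ e₂ x t : ℝ) :
    rho k₁ e₁ e₂ x t = -2 * Complex.I * (2 * k₁ * x + 8 * k₁ ^ 3 * t)
      + (4 * k₁.im * e₁ - Complex.I * (4 * k₁.re * e₂)) := by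
  apply Complex.ext <;> (simp [rho, mu, nu, pow_succ]; try ring)

lemma I_mul_theta_eq (k₁ : ℂ) (r₀ φ₀ x t : ℝ) :
    Complex.I * theta x t k₁ + (-(r₀ : ℂ) + Complex.I * φ₀) =
      ((-r1 k₁ r₀ x t : ℝ) : ℂ) + (phi1 k₁ φ₀ x t : ℝ) * Complex.I := by
  apply Complex.ext <;> (simp [theta, r1, phi1, pow_succ, -mul_eq_mul_right_iff]; ring)

lemma y1_eq_exp {β : ℂ} {r₀ φ₀ : ℝ} (hβ : β = Complex.exp (-(r₀ : ℂ) + Complex.I * φ₀))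
    (x t : ℝ) :
    y1 k₁ β x t = ![Complex.exp (-r1 k₁ r₀ x t + phi1 k₁ φ₀ x t * Complex.I),
      Complex.exp (-(-r1 k₁ r₀ x t + phi1 k₁ φ₀ x t * Complex.I))] := by
  have h := I_mul_theta_eq k₁ r₀ φ₀ x t
  push_cast at h
  rw [y1_eq, hβ, ← Complex.exp_neg, ← Complex.exp_add, ← Complex.exp_add, ← h]
  congr 2
  · ring_nf
  · ring_nf

/-- `Δ⁺` for vectors `⟨ỹ|` proportional to `⟨y|` in each component. -/
lemma Delta_one_cons (k₁ u v m n : ℂ) :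
    Delta k₁ 1 ![u, v] ![u * m, v * n] =
      4 * (4 * (k₁ * conj k₁) * (k₁ * (u * conj u) + conj k₁ * (v * conj v)) ^ 2
        + delta k₁ ^ 2 * ((u * conj u) * (v * conj v)) *
          (1 - k₁ * (n - m)) * (1 + conj k₁ * conj (n - m))) := by
  simp only [Delta, aCoef, bCoef, cCoef, form_eq, Matrix.cons_val_zero, Matrix.cons_val_one,
    map_mul, map_sub, delta]
  ring

/-- The entry `(A₁)₁₂` for vectors `⟨ỹ|` proportional to `⟨y|` in each component. -/
lemma residueB_zero_one_cons (k₁ u v m n : ℂ) :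
    residueB k₁ ![u, v] ![u * m, v * n] 0 1 =
      (4 * (conj u * v) * (delta k₁ ^ 2 * (k₁ * conj k₁) *
          ((n - m) * (u * conj u) + conj (n - m) * (v * conj v))
        + delta k₁ * ((conj k₁ ^ 3 + 3 * conj k₁ * k₁ ^ 2) * (u * conj u)
          + (k₁ ^ 3 + 3 * k₁ * conj k₁ ^ 2) * (v * conj v))))
        / Delta k₁ 1 ![u, v] ![u * m, v * n] := by
  simp only [residueB, Matrix.add_apply, Matrix.vecMulVec_apply, ket_apply_zero,
    ketTilde_apply_zero, Lam, Om, LamTilde, OmTilde]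
  generalize Delta k₁ 1 ![u, v] ![u * m, v * n] = D
  simp only [aCoef, bCoef, cCoef, form_eq, Matrix.cons_val_zero, Matrix.cons_val_one,
    map_mul, map_sub, delta]
  ring

/-- If the imaginary part of `D₂` vanishes, it ties `Im (k₁ ρ)` to `sinh (4 r₁)`; eliminating
`Im (k₁ ρ)` from the real part leaves a sum of squares containing the positive term
`16 (Re k₁)⁴`. -/
lemma D2_ne_zero (hξ : k₁.re ≠ 0) (hη : k₁.im ≠ 0) (r₀ e₁ e₂ x t : ℝ) :
    D2 k₁ r₀ e₁ e₂ x t ≠ 0 := by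
  intro h
  rw [D2, delta_eq] at h
  have hn : ((‖k₁‖ : ℝ) : ℂ) ^ 2 = ((k₁.re ^ 2 + k₁.im ^ 2 : ℝ) : ℂ) := by
    rw [← Complex.ofReal_pow, ← Complex.normSq_eq_norm_sq, Complex.normSq_apply]
    push_cast
    ring
  have hE : Real.exp (-2 * r1 k₁ r₀ x t) * Real.exp (2 * r1 k₁ r₀ x t) = 1 := by
    rw [← Real.exp_add]
    simp
  rw [hn] at h
  generalize Real.exp (-2 * r1 k₁ r₀ x t) = A at *
  generalize Real.exp (2 * r1 k₁ r₀ x t) = B at *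
  generalize rho k₁ e₁ e₂ x t = ρ at *
  have hre := congrArg Complex.re h
  have him := congrArg Complex.im h
  simp [pow_two] at hre him
  obtain ⟨ξ, η⟩ := k₁
  obtain ⟨μ, ν⟩ := ρ
  simp only at *
  have hd : 8 * (ξ ^ 2 + η ^ 2) * ξ ^ 2 * (A - B) ^ 2 + (ξ ^ 2 + η ^ 2) ^ 2 * ((A - B) ^ 2) ^ 2
      + 16 * ξ ^ 4 + 16 * ξ ^ 2 * η ^ 2 * (ξ * μ - η * ν) ^ 2 = 0 := by
    -- `hre` and `him` are the real and the imaginary part of `D₂ = 0`; `8 ξ η` divides the latter.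
    have h8 : 8 * (ξ * η) ≠ 0 := by positivity
    have him' : (ξ ^ 2 + η ^ 2) * (A ^ 2 - B ^ 2) + 4 * ξ * η * (ξ * ν + η * μ) = 0 := by
      apply mul_left_cancel₀ h8
      linear_combination him
    linear_combination hre + ((ξ ^ 2 + η ^ 2) * (A ^ 2 - B ^ 2)
      - 4 * ξ * η * (ξ * ν + η * μ)) * him' - (16 * (ξ ^ 2 + η ^ 2) * ξ ^ 2
        + 4 * (ξ ^ 2 + η ^ 2) ^ 2 * (A - B) ^ 2) * hE
  have : 0 < ξ ^ 4 := by positivity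
  have : 0 ≤ 8 * (ξ ^ 2 + η ^ 2) * ξ ^ 2 * (A - B) ^ 2
    + (ξ ^ 2 + η ^ 2) ^ 2 * ((A - B) ^ 2) ^ 2 := by positivity
  have : 0 ≤ 16 * ξ ^ 2 * η ^ 2 * (ξ * μ - η * ν) ^ 2 := by positivity
  linarith

end ZeroSeed

/-! ### Hirota's bilinear form of the Gerdjikov–Ivanov equation -/

section Hirota

lemma iteratedDeriv_two_of_hasDerivAt {u u' u'' : ℝ → ℂ} (h : ∀ x, HasDerivAt u (u' x) x)
    (h' : ∀ x, HasDerivAt u' (u'' x) x) (x : ℝ) : iteratedDeriv 2 u x = u'' x := by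
  rw [iteratedDeriv_succ, iteratedDeriv_one, funext fun y => (h y).deriv, (h' x).deriv]

/-- Hirota's method for the Gerdjikov–Ivanov equation: `q = g / f` is a solution if
`(i D_t + D_x²) g·f = 0`, `D_x f·f̄ = -(i/2) g ḡ` and `-2 f_xx f̄ + 2 f_x f̄_x = i g ḡ_x`. -/
lemma equation_of_bilinear {f g fx fxx ft gx gxx gt : ℝ → ℝ → ℂ} (hf : ∀ x t, f x t ≠ 0)
    (hfx : ∀ x t, HasDerivAt (fun y => f y t) (fx x t) x)
    (hfxx : ∀ x t, HasDerivAt (fun y => fx y t) (fxx x t) x)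
    (hft : ∀ x t, HasDerivAt (fun s => f x s) (ft x t) t)
    (hgx : ∀ x t, HasDerivAt (fun y => g y t) (gx x t) x)
    (hgxx : ∀ x t, HasDerivAt (fun y => gx y t) (gxx x t) x)
    (hgt : ∀ x t, HasDerivAt (fun s => g x s) (gt x t) t) {x t : ℝ}
    (h₁ : Complex.I * (gt x t * f x t - g x t * ft x t)
      + (gxx x t * f x t - 2 * gx x t * fx x t + g x t * fxx x t) = 0)
    (h₂ : fx x t * conj (f x t) - f x t * conj (fx x t)
      + Complex.I / 2 * (g x t * conj (g x t)) = 0)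
    (h₃ : -2 * fxx x t * conj (f x t) + 2 * fx x t * conj (fx x t)
      - Complex.I * (g x t * conj (gx x t)) = 0) :
    Complex.I * deriv (fun s => g x s / f x s) t + iteratedDeriv 2 (fun y => g y t / f y t) x
      - Complex.I * (g x t / f x t) ^ 2 * deriv (fun y => conj (g y t / f y t)) x
      + (1 / 2) * (g x t / f x t) ^ 3 * conj (g x t / f x t) ^ 2 = 0 := by
  have hqx (y : ℝ) := (hgx y t).fun_div (hfx y t) (hf y t)
  have hqxx (y : ℝ) := (((hgxx y t).fun_mul (hfx y t)).fun_sub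
    ((hgx y t).fun_mul (hfxx y t))).fun_div ((hfx y t).fun_pow 2) (pow_ne_zero 2 (hf y t))
  have hqt := (hgt x t).fun_div (hft x t) (hf x t)
  have hqc : HasDerivAt (fun y => conj (g y t / f y t))
      (conj ((gx x t * f x t - g x t * fx x t) / f x t ^ 2)) x := (hqx x).star
  rw [iteratedDeriv_two_of_hasDerivAt hqx hqxx, hqt.deriv, hqc.deriv]
  have hf₀ := hf x t
  have hf₁ : conj (f x t) ≠ 0 := by simpa using hf₀
  simp only [map_div₀, map_sub, map_mul, map_pow]
  generalize conj (f x t) = fb at *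
  generalize conj (fx x t) = fbx at *
  generalize conj (g x t) = gb at *
  generalize conj (gx x t) = gbx at *
  generalize f x t = f at *
  generalize g x t = g at *
  generalize fx x t = fx at *
  generalize gx x t = gx at *
  generalize fxx x t = fxx at *
  generalize gxx x t = gxx at *
  generalize ft x t = ft at *
  generalize gt x t = gt at *
  have hI : Complex.I ^ 2 = -1 := Complex.I_sq
  generalize Complex.I = i at *
  -- With `hT`, the part of the equation not covered by `h₁` and `h₃` cancels.
  have hT : g * gb = 2 * i * (fx * fb - f * fbx) := by
    linear_combination -2 * i * h₂ + g * gb * hI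
  have hK : i * f * fbx * (g * gb) + (g * gb) ^ 2 / 2 + 2 * fb * fx * (fx * fb - f * fbx) = 0 := by
    linear_combination (i * f * fbx + (g * gb + 2 * i * (fx * fb - f * fbx)) / 2) * hT
      + 2 * (f * fbx + (fx * fb - f * fbx)) * (fx * fb - f * fbx) * hI
  calc _ = (i * (gt * f - g * ft) + (gxx * f - 2 * gx * fx + g * fxx)) / f ^ 2
        + g / (f ^ 3 * fb ^ 2) * (f * fb * (-2 * fxx * fb + 2 * fx * fbx - i * (g * gbx))
          + (i * f * fbx * (g * gb) + (g * gb) ^ 2 / 2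
            + 2 * fb * fx * (fx * fb - f * fbx))) := by
        field_simp
        ring
    _ = 0 := by rw [h₁, h₃, hK]; simp

end Hirota

/-! ### Numerator and denominator as polynomials: derivatives and bilinear identities -/

section Polynomials

/-- The numerator of the soliton as a polynomial in `A = exp (-2 r₁)`, `B = exp (2 r₁)`,
`P = 4 i exp (-2 i φ₁)`, `R = ρ` and `S = conj ρ`, with `k = k₁` and `l = conj k₁`. The
derivatives below are taken along these functions of `x` and `t`. -/
def gPoly (k l A B P R S : ℂ) : ℂ :=
  P * ((k ^ 2 - l ^ 2) ^ 2 * (k * l) * (R * A + S * B)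
    + (k ^ 2 - l ^ 2) * ((l ^ 3 + 3 * l * k ^ 2) * A + (k ^ 3 + 3 * k * l ^ 2) * B))

/-- The `x`-derivative of `gPoly` is `i` times this polynomial. -/
def gPolyX (k l A B P R S : ℂ) : ℂ :=
  P * ((k ^ 2 - l ^ 2) ^ 2 * (k * l) * (-4 * k * A + 4 * l * B + (k ^ 2 - l ^ 2) * (R * A - S * B))
    + (k ^ 2 - l ^ 2) ^ 2 * ((l ^ 3 + 3 * l * k ^ 2) * A - (k ^ 3 + 3 * k * l ^ 2) * B))
  - (k ^ 2 + l ^ 2) * gPoly k l A B P R S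

/-- The second `x`-derivative of `gPoly` is `-1` times this polynomial. -/
def gPolyXX (k l A B P R S : ℂ) : ℂ :=
  P * ((k ^ 2 - l ^ 2) ^ 2 * (k * l) * (-8 * (k ^ 2 - l ^ 2) * (k * A + l * B)
      + (k ^ 2 - l ^ 2) ^ 2 * (R * A + S * B))
    + (k ^ 2 - l ^ 2) ^ 3 * ((l ^ 3 + 3 * l * k ^ 2) * A + (k ^ 3 + 3 * k * l ^ 2) * B))
  - 2 * (k ^ 2 + l ^ 2) * gPolyX k l A B P R S
  - (k ^ 2 + l ^ 2) ^ 2 * gPoly k l A B P R S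

/-- The `t`-derivative of `gPoly` is `i` times this polynomial. -/
def gPolyT (k l A B P R S : ℂ) : ℂ :=
  P * ((k ^ 2 - l ^ 2) ^ 2 * (k * l) * (-16 * k ^ 3 * A + 16 * l ^ 3 * B
      + 2 * (k ^ 4 - l ^ 4) * (R * A - S * B))
    + (k ^ 2 - l ^ 2) * (2 * (k ^ 4 - l ^ 4))
      * ((l ^ 3 + 3 * l * k ^ 2) * A - (k ^ 3 + 3 * k * l ^ 2) * B))
  - 2 * (k ^ 4 + l ^ 4) * gPoly k l A B P R S

/-- The denominator of the soliton as a polynomial in the same quantities as `gPoly`. -/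
def fPoly (k l A B R S : ℂ) : ℂ :=
  4 * (k * l) * (k * A + l * B) ^ 2 + (k ^ 2 - l ^ 2) ^ 2 * (1 - k * R) * (1 + l * S)

/-- The `x`-derivative of `fPoly` is `i` times this polynomial. -/
def fPolyX (k l A B R S : ℂ) : ℂ :=
  8 * (k * l) * (k ^ 2 - l ^ 2) * (k * A + l * B) * (k * A - l * B)
    + 4 * (k ^ 2 - l ^ 2) ^ 2 * (k ^ 2 * (1 + l * S) + l ^ 2 * (1 - k * R))

/-- The second `x`-derivative of `fPoly` is `-1` times this polynomial. -/
def fPolyXX (k l A B : ℂ) : ℂ :=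
  8 * (k * l) * (k ^ 2 - l ^ 2) ^ 2 * ((k * A + l * B) ^ 2 + (k * A - l * B) ^ 2)
    + 32 * (k ^ 2 - l ^ 2) ^ 2 * (k ^ 2 * l ^ 2)

/-- The `t`-derivative of `fPoly` is `i` times this polynomial. -/
def fPolyT (k l A B R S : ℂ) : ℂ :=
  8 * (k * l) * (2 * (k ^ 4 - l ^ 4)) * (k * A + l * B) * (k * A - l * B)
    + 16 * (k ^ 2 - l ^ 2) ^ 2 * (k ^ 4 * (1 + l * S) + l ^ 4 * (1 - k * R))

section derivatives

variable {A B P R S : ℝ → ℂ} {k l a c r s : ℂ} {x : ℝ}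

lemma hasDerivAt_gPoly (hA : HasDerivAt A (a * A x) x) (hB : HasDerivAt B (-a * B x) x)
    (hP : HasDerivAt P (c * P x) x) (hR : HasDerivAt R r x) (hS : HasDerivAt S s x) :
    HasDerivAt (fun y => gPoly k l (A y) (B y) (P y) (R y) (S y))
      (P x * ((k ^ 2 - l ^ 2) ^ 2 * (k * l) * (r * A x + s * B x
          + a * (R x * A x - S x * B x))
        + (k ^ 2 - l ^ 2) * a * ((l ^ 3 + 3 * l * k ^ 2) * A x - (k ^ 3 + 3 * k * l ^ 2) * B x))
        + c * gPoly k l (A x) (B x) (P x) (R x) (S x)) x := by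
  unfold gPoly
  refine (hP.fun_mul
    ((((hR.fun_mul hA).fun_add (hS.fun_mul hB)).const_mul ((k ^ 2 - l ^ 2) ^ 2 * (k * l))).fun_add
    (((hA.const_mul (l ^ 3 + 3 * l * k ^ 2)).fun_add
      (hB.const_mul (k ^ 3 + 3 * k * l ^ 2))).const_mul (k ^ 2 - l ^ 2)))).congr_deriv ?_
  ring

lemma hasDerivAt_fPoly (hA : HasDerivAt A (a * A x) x) (hB : HasDerivAt B (-a * B x) x)
    (hR : HasDerivAt R r x) (hS : HasDerivAt S s x) :
    HasDerivAt (fun y => fPoly k l (A y) (B y) (R y) (S y))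
      (8 * (k * l) * a * (k * A x + l * B x) * (k * A x - l * B x)
        + (k ^ 2 - l ^ 2) ^ 2 * (-k * r * (1 + l * S x) + l * s * (1 - k * R x))) x := by
  unfold fPoly
  refine (((((hA.const_mul k).fun_add (hB.const_mul l)).fun_pow 2).const_mul
    (4 * (k * l))).fun_add ((((hR.const_mul k).const_sub 1).const_mul ((k ^ 2 - l ^ 2) ^ 2)).fun_mul
      ((hS.const_mul l).const_add 1))).congr_deriv ?_
  push_cast
  ring

lemma hasDerivAt_gPolyX (hA : HasDerivAt A (Complex.I * (k ^ 2 - l ^ 2) * A x) x)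
    (hB : HasDerivAt B (-(Complex.I * (k ^ 2 - l ^ 2)) * B x) x)
    (hP : HasDerivAt P (-(Complex.I * (k ^ 2 + l ^ 2)) * P x) x)
    (hR : HasDerivAt R (-4 * Complex.I * k) x) (hS : HasDerivAt S (4 * Complex.I * l) x) :
    HasDerivAt (fun y => gPolyX k l (A y) (B y) (P y) (R y) (S y))
      (Complex.I * gPolyXX k l (A x) (B x) (P x) (R x) (S x)) x := by
  have h := (((hA.const_mul (-4 * k)).fun_add (hB.const_mul (4 * l))).fun_add
    (((hR.fun_mul hA).fun_sub (hS.fun_mul hB)).const_mul (k ^ 2 - l ^ 2))).const_mul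
      ((k ^ 2 - l ^ 2) ^ 2 * (k * l))
  have h' := ((hA.const_mul (l ^ 3 + 3 * l * k ^ 2)).fun_sub
    (hB.const_mul (k ^ 3 + 3 * k * l ^ 2))).const_mul ((k ^ 2 - l ^ 2) ^ 2)
  refine ((hP.fun_mul (h.fun_add h')).fun_sub
    ((hasDerivAt_gPoly hA hB hP hR hS).const_mul (k ^ 2 + l ^ 2))).congr_deriv ?_
  simp only [gPolyXX, gPolyX, gPoly]
  ring

lemma hasDerivAt_fPolyX (hA : HasDerivAt A (Complex.I * (k ^ 2 - l ^ 2) * A x) x)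
    (hB : HasDerivAt B (-(Complex.I * (k ^ 2 - l ^ 2)) * B x) x)
    (hR : HasDerivAt R (-4 * Complex.I * k) x) (hS : HasDerivAt S (4 * Complex.I * l) x) :
    HasDerivAt (fun y => fPolyX k l (A y) (B y) (R y) (S y))
      (Complex.I * fPolyXX k l (A x) (B x)) x := by
  unfold fPolyX
  refine (((((hA.const_mul k).fun_add (hB.const_mul l)).const_mul
    (8 * (k * l) * (k ^ 2 - l ^ 2))).fun_mul ((hA.const_mul k).fun_sub (hB.const_mul l))).fun_add
    (((((hS.const_mul l).const_add 1).const_mul (k ^ 2)).fun_add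
      (((hR.const_mul k).const_sub 1).const_mul (l ^ 2))).const_mul
        (4 * (k ^ 2 - l ^ 2) ^ 2))).congr_deriv ?_
  simp only [fPolyXX]
  ring

end derivatives

section bilinear

variable {k l A B P Q R S : ℂ}

/-- `(i D_t + D_x²) g·f = 0`. -/
lemma bilinear_dispersion (hAB : A * B = 1) :
    gPolyT k l A B P R S * fPoly k l A B R S - gPoly k l A B P R S * fPolyT k l A B R S
      + (gPolyXX k l A B P R S * fPoly k l A B R S
        - 2 * gPolyX k l A B P R S * fPolyX k l A B R S
        + gPoly k l A B P R S * fPolyXX k l A B) = 0 := by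
  have hA : A ≠ 0 := left_ne_zero_of_mul_eq_one hAB
  obtain rfl : B = A⁻¹ := eq_inv_of_mul_eq_one_right hAB
  simp only [gPolyXX, gPolyT, gPolyX, gPoly, fPolyT, fPolyX, fPolyXX, fPoly]
  field_simp
  ring

/-- `D_x f·f̄ = -(i/2) g ḡ`. -/
lemma bilinear_first_order (hAB : A * B = 1) (hPQ : P * Q = 16) :
    fPolyX k l A B R S * fPoly l k A B S R + fPoly k l A B R S * fPolyX l k A B S R
      + 1 / 2 * (gPoly k l A B P R S * gPoly l k A B Q S R) = 0 := by
  have hA : A ≠ 0 := left_ne_zero_of_mul_eq_one hAB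
  have hP : P ≠ 0 := by rintro rfl; simp at hPQ
  obtain rfl : B = A⁻¹ := eq_inv_of_mul_eq_one_right hAB
  obtain rfl : Q = 16 / P := by rw [eq_div_iff hP, mul_comm, hPQ]
  simp only [gPoly, fPolyX, fPoly]
  field_simp
  ring

/-- `-2 f_xx f̄ + 2 f_x f̄_x = i g ḡ_x`. -/
lemma bilinear_second_order (hAB : A * B = 1) (hPQ : P * Q = 16) :
    2 * fPolyXX k l A B * fPoly l k A B S R + 2 * fPolyX k l A B R S * fPolyX l k A B S R
      - gPoly k l A B P R S * gPolyX l k A B Q S R = 0 := by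
  have hA : A ≠ 0 := left_ne_zero_of_mul_eq_one hAB
  have hP : P ≠ 0 := by rintro rfl; simp at hPQ
  obtain rfl : B = A⁻¹ := eq_inv_of_mul_eq_one_right hAB
  obtain rfl : Q = 16 / P := by rw [eq_div_iff hP, mul_comm, hPQ]
  simp only [gPoly, gPolyX, fPolyX, fPolyXX, fPoly]
  field_simp
  ring

end bilinear

end Polynomials

/-! ### The explicit formula solves the equation -/

section Explicit

section conjugation

variable (k l A B P R S : ℂ)

lemma conj_fPoly : conj (fPoly k l A B R S) =
    fPoly (conj k) (conj l) (conj A) (conj B) (conj R) (conj S) := by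
  simp [fPoly, map_ofNat]

lemma conj_fPolyX : conj (fPolyX k l A B R S) =
    fPolyX (conj k) (conj l) (conj A) (conj B) (conj R) (conj S) := by
  simp [fPolyX, map_ofNat]

lemma conj_gPoly : conj (gPoly k l A B P R S) =
    gPoly (conj k) (conj l) (conj A) (conj B) (conj P) (conj R) (conj S) := by
  simp [gPoly, map_ofNat]

lemma conj_gPolyX : conj (gPolyX k l A B P R S) =
    gPolyX (conj k) (conj l) (conj A) (conj B) (conj P) (conj R) (conj S) := by
  simp [gPolyX, conj_gPoly, map_ofNat]

end conjugation

section soliton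

variable (k₁ : ℂ) (r₀ φ₀ e₁ e₂ : ℝ)

/-- The numerator of the soliton is a specialization of `gPoly`; the shift of `φ̃₁` by `-π / 2`
accounts for the factor `i` in the fourth argument. -/
lemma numerator_eq (x t : ℝ) :
    4 * Complex.exp (-(Complex.I * phi1Tilde k₁ φ₀ x t)) * N2 k₁ r₀ e₁ e₂ x t =
      gPoly k₁ (conj k₁) (Real.exp (-2 * r1 k₁ r₀ x t)) (Real.exp (2 * r1 k₁ r₀ x t))
        (4 * Complex.I * Complex.exp (-(2 * Complex.I * phi1 k₁ φ₀ x t)))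
        (rho k₁ e₁ e₂ x t) (conj (rho k₁ e₁ e₂ x t)) := by
  have h : Complex.exp (-(Complex.I * phi1Tilde k₁ φ₀ x t)) =
      Complex.I * Complex.exp (-(2 * Complex.I * phi1 k₁ φ₀ x t)) := by
    rw [phi1Tilde]
    push_cast
    rw [show -(Complex.I * (2 * (phi1 k₁ φ₀ x t : ℂ) - Real.pi / 2)) =
      Real.pi / 2 * Complex.I + -(2 * Complex.I * phi1 k₁ φ₀ x t) by ring, Complex.exp_add,
      Complex.exp_pi_div_two_mul_I]
  rw [h, N2, gPoly, delta, ← Complex.mul_conj']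
  ring

lemma D2_eq_fPoly (x t : ℝ) :
    D2 k₁ r₀ e₁ e₂ x t =
      fPoly k₁ (conj k₁) (Real.exp (-2 * r1 k₁ r₀ x t)) (Real.exp (2 * r1 k₁ r₀ x t))
        (rho k₁ e₁ e₂ x t) (conj (rho k₁ e₁ e₂ x t)) := by
  rw [D2, fPoly, delta, ← Complex.mul_conj']

lemma hasDerivAt_r1_x (x t : ℝ) :
    HasDerivAt (fun y => r1 k₁ r₀ y t) (2 * k₁.re * k₁.im) x := by
  unfold r1
  exact ((((hasDerivAt_id x).const_mul _).add_const _).add_const r₀).congr_deriv (mul_one _)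

lemma hasDerivAt_r1_t (x t : ℝ) :
    HasDerivAt (fun s => r1 k₁ r₀ x s) (8 * k₁.re * k₁.im * (k₁.re ^ 2 - k₁.im ^ 2)) t := by
  unfold r1
  exact ((((hasDerivAt_id t).const_mul _).const_add _).add_const r₀).congr_deriv (mul_one _)

lemma hasDerivAt_phi1_x (x t : ℝ) :
    HasDerivAt (fun y => phi1 k₁ φ₀ y t) (k₁.re ^ 2 - k₁.im ^ 2) x := by
  unfold phi1
  exact ((((hasDerivAt_id x).const_mul _).add_const _).add_const φ₀).congr_deriv (mul_one _)

lemma hasDerivAt_phi1_t (x t : ℝ) :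
    HasDerivAt (fun s => phi1 k₁ φ₀ x s)
      (2 * ((k₁.re ^ 2 - k₁.im ^ 2) ^ 2 - 4 * k₁.re ^ 2 * k₁.im ^ 2)) t := by
  unfold phi1
  exact ((((hasDerivAt_id t).const_mul _).const_add _).add_const φ₀).congr_deriv (mul_one _)

lemma hasDerivAt_rho_x (x t : ℝ) :
    HasDerivAt (fun y => rho k₁ e₁ e₂ y t) (-4 * Complex.I * k₁) x := by
  simp only [rho_eq]
  refine (((((hasDerivAt_id x).ofReal_comp.const_mul (2 * k₁)).add_const _).const_mul
    (-2 * Complex.I)).add_const _).congr_deriv ?_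
  push_cast
  ring

lemma hasDerivAt_rho_t (x t : ℝ) :
    HasDerivAt (fun s => rho k₁ e₁ e₂ x s) (-16 * Complex.I * k₁ ^ 3) t := by
  simp only [rho_eq]
  refine (((((hasDerivAt_id t).ofReal_comp.const_mul (8 * k₁ ^ 3)).const_add _).const_mul
    (-2 * Complex.I)).add_const _).congr_deriv ?_
  push_cast
  ring

lemma hasDerivAt_conj_rho_x (x t : ℝ) :
    HasDerivAt (fun y => conj (rho k₁ e₁ e₂ y t)) (4 * Complex.I * conj k₁) x := by
  simpa [map_ofNat] using (hasDerivAt_rho_x k₁ e₁ e₂ x t).star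

lemma hasDerivAt_conj_rho_t (x t : ℝ) :
    HasDerivAt (fun s => conj (rho k₁ e₁ e₂ x s)) (16 * Complex.I * conj k₁ ^ 3) t := by
  simpa [map_ofNat] using (hasDerivAt_rho_t k₁ e₁ e₂ x t).star

lemma hasDerivAt_ofReal_exp {h : ℝ → ℝ} {h' x : ℝ} {a : ℂ} (hh : HasDerivAt h h' x) (c : ℝ)
    (ha : a = c * h') :
    HasDerivAt (fun y => ((Real.exp (c * h y) : ℝ) : ℂ)) (a * (Real.exp (c * h x) : ℝ)) x := by
  refine (hh.const_mul c).exp.ofReal_comp.congr_deriv ?_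
  rw [ha]
  push_cast
  ring

lemma hasDerivAt_phase {h : ℝ → ℝ} {h' x : ℝ} {a : ℂ} (hh : HasDerivAt h h' x)
    (ha : a = -(2 * Complex.I * h')) :
    HasDerivAt (fun y => 4 * Complex.I * Complex.exp (-(2 * Complex.I * h y)))
      (a * (4 * Complex.I * Complex.exp (-(2 * Complex.I * h x)))) x := by
  refine (((hh.ofReal_comp.const_mul (2 * Complex.I)).fun_neg.cexp).const_mul
    (4 * Complex.I)).congr_deriv ?_
  rw [ha]
  ring

/-- The explicit soliton solves the equation, by `equation_of_bilinear`. -/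
theorem equation_explicit (hξ : k₁.re ≠ 0) (hη : k₁.im ≠ 0) (x t : ℝ) {q : ℝ → ℝ → ℂ}
    (hq : ∀ x t, q x t = 4 * Complex.exp (-(Complex.I * phi1Tilde k₁ φ₀ x t)) *
      (N2 k₁ r₀ e₁ e₂ x t / D2 k₁ r₀ e₁ e₂ x t)) :
    Complex.I * deriv (fun s => q x s) t + iteratedDeriv 2 (fun y => q y t) x
      - Complex.I * q x t ^ 2 * deriv (fun y => conj (q y t)) x
      + (1 / 2) * q x t ^ 3 * conj (q x t) ^ 2 = 0 := by
  have hf (x t : ℝ) := D2_ne_zero hξ hη r₀ e₁ e₂ x t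
  simp only [hq, ← mul_div_assoc, numerator_eq]
  simp only [D2_eq_fPoly] at hf ⊢
  have hI : Complex.I ^ 2 = -1 := Complex.I_sq
  have c₁ : k₁ ^ 2 - conj k₁ ^ 2 = 4 * Complex.I * k₁.re * k₁.im := delta_eq k₁
  have c₂ : k₁ ^ 2 + conj k₁ ^ 2 = 2 * ((k₁.re ^ 2 - k₁.im ^ 2 : ℝ) : ℂ) := by
    apply Complex.ext <;> simp [pow_two] <;> ring
  have c₃ : k₁ ^ 4 - conj k₁ ^ 4 = 8 * Complex.I * k₁.re * k₁.im
      * ((k₁.re ^ 2 - k₁.im ^ 2 : ℝ) : ℂ) := by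
    linear_combination (k₁ ^ 2 + conj k₁ ^ 2) * c₁ + 4 * Complex.I * k₁.re * k₁.im * c₂
  have c₄ : k₁ ^ 4 + conj k₁ ^ 4 =
      2 * (((k₁.re ^ 2 - k₁.im ^ 2) ^ 2 - 4 * k₁.re ^ 2 * k₁.im ^ 2 : ℝ) : ℂ) := by
    push_cast at c₂ ⊢
    linear_combination (k₁ ^ 2 - conj k₁ ^ 2 + 4 * Complex.I * k₁.re * k₁.im) / 2 * c₁
      + (k₁ ^ 2 + conj k₁ ^ 2 + 2 * (k₁.re ^ 2 - k₁.im ^ 2)) / 2 * c₂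
      + 8 * k₁.re ^ 2 * k₁.im ^ 2 * hI
  have hAx (x t : ℝ) := hasDerivAt_ofReal_exp (a := Complex.I * (k₁ ^ 2 - conj k₁ ^ 2))
    (hasDerivAt_r1_x k₁ r₀ x t) (-2) (by
      rw [c₁]; push_cast; linear_combination 4 * k₁.re * k₁.im * hI)
  have hBx (x t : ℝ) := hasDerivAt_ofReal_exp (a := -(Complex.I * (k₁ ^ 2 - conj k₁ ^ 2)))
    (hasDerivAt_r1_x k₁ r₀ x t) 2 (by
      rw [c₁]; push_cast; linear_combination -4 * k₁.re * k₁.im * hI)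
  have hPx (x t : ℝ) := hasDerivAt_phase (a := -(Complex.I * (k₁ ^ 2 + conj k₁ ^ 2)))
    (hasDerivAt_phi1_x k₁ φ₀ x t) (by rw [c₂]; ring)
  have hAt (x t : ℝ) := hasDerivAt_ofReal_exp (a := 2 * Complex.I * (k₁ ^ 4 - conj k₁ ^ 4))
    (hasDerivAt_r1_t k₁ r₀ x t) (-2) (by
      rw [c₃]; push_cast
      linear_combination 16 * k₁.re * k₁.im * (k₁.re ^ 2 - k₁.im ^ 2) * hI)
  have hBt (x t : ℝ) := hasDerivAt_ofReal_exp (a := -(2 * Complex.I * (k₁ ^ 4 - conj k₁ ^ 4)))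
    (hasDerivAt_r1_t k₁ r₀ x t) 2 (by
      rw [c₃]; push_cast
      linear_combination -16 * k₁.re * k₁.im * (k₁.re ^ 2 - k₁.im ^ 2) * hI)
  have hPt (x t : ℝ) := hasDerivAt_phase (a := -(2 * Complex.I * (k₁ ^ 4 + conj k₁ ^ 4)))
    (hasDerivAt_phi1_t k₁ φ₀ x t) (by rw [c₄]; push_cast; ring)
  have hRx := hasDerivAt_rho_x k₁ e₁ e₂
  have hRt := hasDerivAt_rho_t k₁ e₁ e₂
  have hSx := hasDerivAt_conj_rho_x k₁ e₁ e₂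
  have hSt := hasDerivAt_conj_rho_t k₁ e₁ e₂
  have hAB : ((Real.exp (-2 * r1 k₁ r₀ x t) : ℝ) : ℂ) * (Real.exp (2 * r1 k₁ r₀ x t) : ℝ) = 1 := by
    rw [← Complex.ofReal_mul, ← Real.exp_add]
    simp
  have hPQ : 4 * Complex.I * Complex.exp (-(2 * Complex.I * phi1 k₁ φ₀ x t))
      * conj (4 * Complex.I * Complex.exp (-(2 * Complex.I * phi1 k₁ φ₀ x t))) = 16 := by
    rw [Complex.mul_conj', norm_mul, Complex.norm_exp]
    simp
    norm_num
  refine equation_of_bilinear hf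
    (fun x t => (hasDerivAt_fPoly (hAx x t) (hBx x t) (hRx x t) (hSx x t)).congr_deriv
      (g' := Complex.I * fPolyX k₁ (conj k₁) (Real.exp (-2 * r1 k₁ r₀ x t))
        (Real.exp (2 * r1 k₁ r₀ x t)) (rho k₁ e₁ e₂ x t) (conj (rho k₁ e₁ e₂ x t))) ?_)
    (fun x t => (hasDerivAt_fPolyX (hAx x t) (hBx x t) (hRx x t) (hSx x t)).const_mul Complex.I)
    (fun x t => (hasDerivAt_fPoly (hAt x t) (hBt x t) (hRt x t) (hSt x t)).congr_deriv
      (g' := Complex.I * fPolyT k₁ (conj k₁) (Real.exp (-2 * r1 k₁ r₀ x t))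
        (Real.exp (2 * r1 k₁ r₀ x t)) (rho k₁ e₁ e₂ x t) (conj (rho k₁ e₁ e₂ x t))) ?_)
    (fun x t => (hasDerivAt_gPoly (hAx x t) (hBx x t) (hPx x t) (hRx x t) (hSx x t)).congr_deriv
      (g' := Complex.I * gPolyX k₁ (conj k₁) (Real.exp (-2 * r1 k₁ r₀ x t))
        (Real.exp (2 * r1 k₁ r₀ x t))
        (4 * Complex.I * Complex.exp (-(2 * Complex.I * phi1 k₁ φ₀ x t)))
        (rho k₁ e₁ e₂ x t) (conj (rho k₁ e₁ e₂ x t))) ?_)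
    (fun x t => (hasDerivAt_gPolyX (hAx x t) (hBx x t) (hPx x t) (hRx x t) (hSx x t)).const_mul
      Complex.I)
    (fun x t => (hasDerivAt_gPoly (hAt x t) (hBt x t) (hPt x t) (hRt x t) (hSt x t)).congr_deriv
      (g' := Complex.I * gPolyT k₁ (conj k₁) (Real.exp (-2 * r1 k₁ r₀ x t))
        (Real.exp (2 * r1 k₁ r₀ x t))
        (4 * Complex.I * Complex.exp (-(2 * Complex.I * phi1 k₁ φ₀ x t)))
        (rho k₁ e₁ e₂ x t) (conj (rho k₁ e₁ e₂ x t))) ?_)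
    ?_ ?_ ?_
  · rw [fPolyX]; ring
  · rw [fPolyT]; ring
  · rw [gPolyX]; ring
  · rw [gPolyT]; ring
  all_goals
    generalize 4 * Complex.I * Complex.exp (-(2 * Complex.I * phi1 k₁ φ₀ x t)) = P at *
    generalize Real.exp (-2 * r1 k₁ r₀ x t) = A at *
    generalize Real.exp (2 * r1 k₁ r₀ x t) = B at *
    generalize rho k₁ e₁ e₂ x t = R at *
  · linear_combination Complex.I ^ 2 * bilinear_dispersion (k := k₁) (l := conj k₁) (P := P)
      (R := R) (S := conj R) hAB
  · simp only [map_mul, Complex.conj_I, conj_fPoly, conj_fPolyX, conj_gPoly, Complex.conj_conj,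
      Complex.conj_ofReal]
    linear_combination Complex.I * bilinear_first_order (k := k₁) (l := conj k₁)
      (R := R) (S := conj R) hAB hPQ
  · simp only [map_mul, Complex.conj_I, conj_fPoly, conj_fPolyX, conj_gPolyX, Complex.conj_conj,
      Complex.conj_ofReal]
    linear_combination -Complex.I ^ 2 * bilinear_second_order (k := k₁) (l := conj k₁)
      (R := R) (S := conj R) hAB hPQ

end soliton

end Explicit

/-! ### The dressing construction yields the explicit formula -/

section Construction

variable {k₁ β₁ ε₁ ε₂ : ℂ} {r₀ φ₀ e₁ e₂ : ℝ}

/-- The moduli and the phases of the components of `⟨y|`, and `ρ` as the difference of the ratios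
of the components of `⟨ỹ|` and `⟨y|`. -/
lemma exists_y1_y1Tilde_eq (hβ : β₁ = Complex.exp (-(r₀ : ℂ) + Complex.I * φ₀))
    (hε : ε₂ - ε₁ = 4 * k₁.im * e₁ - Complex.I * (4 * k₁.re * e₂)) (x t : ℝ) :
    ∃ u v m n : ℂ, y1 k₁ β₁ x t = ![u, v] ∧ y1Tilde k₁ β₁ ε₁ ε₂ x t = ![u * m, v * n] ∧
      n - m = rho k₁ e₁ e₂ x t ∧ u * conj u = Real.exp (-2 * r1 k₁ r₀ x t) ∧
      v * conj v = Real.exp (2 * r1 k₁ r₀ x t) ∧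
      conj u * v = Complex.exp (-(2 * Complex.I * phi1 k₁ φ₀ x t)) := by
  refine ⟨_, _, ε₁ + Complex.I * (2 * k₁ * x + 8 * k₁ ^ 3 * t),
    ε₂ - Complex.I * (2 * k₁ * x + 8 * k₁ ^ 3 * t), y1_eq_exp hβ x t, ?_, ?_, ?_, ?_, ?_⟩
  · rw [y1Tilde_eq, y1_eq_exp hβ]
    rfl
  · rw [rho_eq, ← hε]
    ring
  all_goals
    rw [← Complex.exp_conj, ← Complex.exp_add]
    try rw [Complex.ofReal_exp]
    congr 1
    simp
    ring

lemma Delta_one_eq_D2 (hβ : β₁ = Complex.exp (-(r₀ : ℂ) + Complex.I * φ₀))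
    (hε : ε₂ - ε₁ = 4 * k₁.im * e₁ - Complex.I * (4 * k₁.re * e₂)) (x t : ℝ) :
    Delta k₁ 1 (y1 k₁ β₁ x t) (y1Tilde k₁ β₁ ε₁ ε₂ x t) = 4 * D2 k₁ r₀ e₁ e₂ x t := by
  obtain ⟨u, v, m, n, hy, hy', hρ, hu, hv, -⟩ := exists_y1_y1Tilde_eq hβ hε x t
  rw [hy, hy', Delta_one_cons, hρ, hu, hv, D2, ← Complex.mul_conj', ← Complex.ofReal_mul,
    ← Real.exp_add]
  simp

lemma twoOrderSoliton_eq (hβ : β₁ = Complex.exp (-(r₀ : ℂ) + Complex.I * φ₀))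
    (hε : ε₂ - ε₁ = 4 * k₁.im * e₁ - Complex.I * (4 * k₁.re * e₂)) (x t : ℝ) :
    twoOrderSoliton k₁ β₁ ε₁ ε₂ x t =
      4 * Complex.exp (-(Complex.I * phi1Tilde k₁ φ₀ x t)) *
        (N2 k₁ r₀ e₁ e₂ x t / D2 k₁ r₀ e₁ e₂ x t) := by
  have hD := Delta_one_eq_D2 hβ hε x t
  obtain ⟨u, v, m, n, hy, hy', hρ, hu, hv, huv⟩ := exists_y1_y1Tilde_eq hβ hε x t
  rw [hy, hy'] at hD
  rw [← mul_div_assoc, numerator_eq, twoOrderSoliton, A1, hy, hy', residueB_zero_one_cons, hD,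
    hρ, hu, hv, huv, gPoly, delta, mul_assoc 4 (Complex.exp _),
    mul_div_mul_left _ _ (by norm_num : (4 : ℂ) ≠ 0)]
  ring

lemma contDiff_r1 (k₁ : ℂ) (r₀ : ℝ) : ContDiff ℝ ∞ (fun p : ℝ × ℝ => r1 k₁ r₀ p.1 p.2) := by
  unfold r1
  fun_prop

lemma contDiff_phi1 (k₁ : ℂ) (φ₀ : ℝ) :
    ContDiff ℝ ∞ (fun p : ℝ × ℝ => phi1 k₁ φ₀ p.1 p.2) := by
  unfold phi1
  fun_prop

lemma contDiff_rho (k₁ : ℂ) (e₁ e₂ : ℝ) :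
    ContDiff ℝ ∞ (fun p : ℝ × ℝ => rho k₁ e₁ e₂ p.1 p.2) := by
  have hμ : ContDiff ℝ ∞ (fun p : ℝ × ℝ => mu k₁ e₁ p.1 p.2) := by
    unfold mu
    fun_prop
  have hν : ContDiff ℝ ∞ (fun p : ℝ × ℝ => nu k₁ e₂ p.1 p.2) := by
    unfold nu
    fun_prop
  exact (Complex.ofRealCLM.contDiff.comp hμ).sub
    (contDiff_const.mul (Complex.ofRealCLM.contDiff.comp hν))

/-- The explicit soliton is smooth because its denominator has no zeros. -/
theorem contDiff_twoOrderSoliton (hξ : k₁.re ≠ 0) (hη : k₁.im ≠ 0)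
    (hβ : β₁ = Complex.exp (-(r₀ : ℂ) + Complex.I * φ₀))
    (hε : ε₂ - ε₁ = 4 * k₁.im * e₁ - Complex.I * (4 * k₁.re * e₂)) :
    ContDiff ℝ ∞ (fun p : ℝ × ℝ => twoOrderSoliton k₁ β₁ ε₁ ε₂ p.1 p.2) := by
  have hf (p : ℝ × ℝ) := D2_ne_zero hξ hη r₀ e₁ e₂ p.1 p.2
  simp only [twoOrderSoliton_eq hβ hε, ← mul_div_assoc, numerator_eq]
  simp only [D2_eq_fPoly] at hf ⊢
  have hA : ContDiff ℝ ∞ (fun p : ℝ × ℝ => ((Real.exp (-2 * r1 k₁ r₀ p.1 p.2) : ℝ) : ℂ)) :=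
    Complex.ofRealCLM.contDiff.comp (contDiff_const.mul (contDiff_r1 k₁ r₀)).exp
  have hB : ContDiff ℝ ∞ (fun p : ℝ × ℝ => ((Real.exp (2 * r1 k₁ r₀ p.1 p.2) : ℝ) : ℂ)) :=
    Complex.ofRealCLM.contDiff.comp (contDiff_const.mul (contDiff_r1 k₁ r₀)).exp
  have hP : ContDiff ℝ ∞ (fun p : ℝ × ℝ =>
      4 * Complex.I * Complex.exp (-(2 * Complex.I * phi1 k₁ φ₀ p.1 p.2))) :=
    contDiff_const.mul (contDiff_const.mul
      (Complex.ofRealCLM.contDiff.comp (contDiff_phi1 k₁ φ₀))).neg.cexp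
  have hR := contDiff_rho k₁ e₁ e₂
  have hS : ContDiff ℝ ∞ (fun p : ℝ × ℝ => conj (rho k₁ e₁ e₂ p.1 p.2)) :=
    Complex.conjCLE.contDiff.comp hR
  simp only [div_eq_mul_inv]
  refine ContDiff.mul ?_ (ContDiff.inv ?_ hf)
  · unfold gPoly
    fun_prop
  · unfold fPoly
    fun_prop

end Construction

end GI

theorem mainTheorem4 (k₁ : ℂ) (hξ : k₁.re ≠ 0) (hη : k₁.im ≠ 0)
    (β₁ ε₁ ε₂ : ℂ) (r₀ φ₀ e₁ e₂ : ℝ)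
    (hβ : β₁ = Complex.exp (-(r₀ : ℂ) + Complex.I * φ₀))
    (hε : ε₂ - ε₁ = 4 * k₁.im * e₁ - Complex.I * (4 * k₁.re * e₂)) :
    -- the construction is well defined at every point
    (∀ x t : ℝ,
      GI.Delta k₁ 1 (GI.y1 k₁ β₁ x t) (GI.y1Tilde k₁ β₁ ε₁ ε₂ x t) ≠ 0 ∧
      GI.Delta k₁ (-1) (GI.y1 k₁ β₁ x t) (GI.y1Tilde k₁ β₁ ε₁ ε₂ x t) ≠ 0) ∧
    -- `A₁`, `Ã₁` are the coefficients of a dressing factor `G` with `G⁻¹(k) = G†(conj k)`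
    (∀ x t : ℝ, ∀ k : ℂ, k ≠ k₁ → k ≠ -k₁ → k ≠ conj k₁ → k ≠ -conj k₁ →
      GI.twoPole k₁ (GI.A1 k₁ β₁ ε₁ ε₂ x t) (GI.A1Tilde k₁ β₁ ε₁ ε₂ x t) k *
        GI.twoPole (conj k₁) (GI.A1 k₁ β₁ ε₁ ε₂ x t)ᴴ (GI.A1Tilde k₁ β₁ ε₁ ε₂ x t)ᴴ k = 1) ∧
    -- `ρ = ε₂ - ε₁ - 2 i θ'(k₁)`
    (∀ x t : ℝ,
      GI.rho k₁ e₁ e₂ x t = -2 * Complex.I * deriv (GI.theta x t) k₁ + ε₂ - ε₁) ∧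
    -- the explicit formula
    (∀ x t : ℝ, GI.D2 k₁ r₀ e₁ e₂ x t ≠ 0 ∧
      GI.twoOrderSoliton k₁ β₁ ε₁ ε₂ x t =
        4 * Complex.exp (-(Complex.I * GI.phi1Tilde k₁ φ₀ x t)) *
          (GI.N2 k₁ r₀ e₁ e₂ x t / GI.D2 k₁ r₀ e₁ e₂ x t)) ∧
    -- it solves the Gerdjikov–Ivanov equation
    GI.IsSolution (GI.twoOrderSoliton k₁ β₁ ε₁ ε₂) := by
  have hD := GI.D2_ne_zero hξ hη r₀ e₁ e₂
  have hΔ (x t : ℝ) :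
      GI.Delta k₁ 1 (GI.y1 k₁ β₁ x t) (GI.y1Tilde k₁ β₁ ε₁ ε₂ x t) ≠ 0 := by
    rw [GI.Delta_one_eq_D2 hβ hε]
    exact mul_ne_zero (by norm_num) (hD x t)
  have hΔ' (x t : ℝ) :
      GI.Delta k₁ (-1) (GI.y1 k₁ β₁ x t) (GI.y1Tilde k₁ β₁ ε₁ ε₂ x t) ≠ 0 := by
    rw [← GI.conj_Delta (map_one _)]
    exact (map_ne_zero _).2 (hΔ x t)
  refine ⟨fun x t => ⟨hΔ x t, hΔ' x t⟩, fun x t k h₁ h₂ h₃ h₄ =>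
    GI.twoPole_residue_mul_eq_one hξ hη (hΔ x t) (hΔ' x t) h₁ h₂ h₃ h₄, fun x t => ?_,
    fun x t => ⟨hD x t, GI.twoOrderSoliton_eq hβ hε x t⟩,
    GI.contDiff_twoOrderSoliton hξ hη hβ hε,
    fun x t => GI.equation_explicit k₁ r₀ φ₀ e₁ e₂ hξ hη x t (GI.twoOrderSoliton_eq hβ hε)⟩
  rw [(GI.hasDerivAt_theta x t k₁).deriv, GI.rho_eq, ← hε]
  ring
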